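/- Let $p$ be a prime, $k$ a perfect field of characteristic $p$, $N$ a lattice (a free abelian group of finite rank), $M=\mathrm{Hom}(N,\mathbb Z)$, $N_{\mathbb R}=N\otimes\mathbb R$, $M_{\mathbb R}=M\otimes\mathbb R=\mathrm{Hom}(N_{\mathbb R},\mathbb R)$. Let $\sigma\subset N_{\mathbb R}$ be a strongly convex rational polyhedral cone, $\sigma^\vee\subset M_{\mathbb R}$ its dual cone, and $X=\operatorname{Spec}k[\sigma^\vee\cap M]$ the corresponding affine toric variety. The primitive generators $v_1,\dots,v_r\in N$ of $\sigma$ are the primitive lattice vectors on the one-dimensional faces of $\sigma$, and $$P_\sigma=\{w\in M_{\mathbb R} : 0\le w\cdot v_i<1\ \text{for all } i\}.$$ $\mathrm{Vol}$ denotes the volume on $M_{\mathbb R}$ normalized so that a fundamental parallelepiped of $M$ has volume $1$. For a coordinate ring $R$ of dimension $d$ as above, let $F^e_*R$ be the abelian group $R$ with the $R$-module structure $r\cdot s=r^{p^e}s$, and let $a_e$ be its free rank: the number of copies of $R$ in a decomposition of $F^e_*R$ as a direct sum of indecomposable modules, which is also the largest rank of a free direct summand of $F^e_*R$. The $F$-signature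 of $R$ is $s(R)=\lim_{e\to\infty}a_e/p^{ed}$. 1. If $X$ has no torus factors, i.e. $\sigma$ spans $N_{\mathbb R}$, then $s(k[X])$ exists and equals $\mathrm{Vol}(P_\sigma)$, which is finite. 2. In general, let $N'_{\mathbb R}$ be the linear span of $\sigma$, $N'=N\cap N'_{\mathbb R}$, and $\sigma'$ the cone $\sigma$ viewed in $N'_{\mathbb R}$. Then $\mathrm{Vol}(P_{\sigma'})$ (relative to the lattice $\mathrm{Hom}(N',\mathbb Z)$) is finite, and if $X\cong X'\times T$ over $k$, where $X'$ is an affine toric variety without torus factors and $T=\operatorname{Spec}k[\mathbb Z^m]$ is an algebraic torus, then $s(k[X])$ and $s(k[X'])$ exist and $$s(k[X])=s(k[X'])=\mathrm{Vol}(P_{\sigma'}).$$ In particular, $s(k[X])=\mathrm{Vol}(P_{\sigma'})$ for every $\sigma$, and the same holds with $X'$ the affine toric variety of $\sigma'$. -/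

import Mathlib

open scoped TensorProduct

noncomputable section

/-! ### Free rank and F-signature -/

/-- The `R`-module `F^e_* R`: the additive group of `R` with scalar multiplication
`r • s = r ^ (p ^ e) * s`. -/
def FrobeniusPushforward (_p _e : ℕ) (R : Type*) : Type _ := R

instance (p e : ℕ) (R : Type*) [CommRing R] : AddCommGroup (FrobeniusPushforward p e R) :=
  inferInstanceAs (AddCommGroup R)

instance (p e : ℕ) (R : Type*) [CommRing R] [ExpChar R p] :
    Module R (FrobeniusPushforward p e R) :=
  Module.compHom R (iterateFrobenius R p e)

/-- A nonzero module that is not the direct sum of two nonzero submodules. -/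
def IsIndecomposableModule (R M : Type*) [CommRing R] [AddCommGroup M] [Module R M] : Prop :=
  Nontrivial M ∧ ∀ A B : Submodule R M, IsCompl A B → A = ⊥ ∨ B = ⊥

/-- `a` is the free rank of the `R`-module `M`: `M` is a finite direct sum of indecomposable
submodules, exactly `a` of which are isomorphic to `R`, and no decomposition of `M` contains more
copies of `R`, i.e. every free module `R ^ b` that is a direct summand (equivalently, a quotient)
of `M` has `b ≤ a`. The second clause makes `a` unique over every ring, without
a Krull–Schmidt theorem. -/
def IsFreeRank (R M : Type*) [CommRing R] [AddCommGroup M] [Module R M] (a : ℕ) : Prop :=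
  (∃ (n : ℕ) (A : Fin n → Submodule R M),
      DirectSum.IsInternal A ∧ (∀ i, IsIndecomposableModule R (A i)) ∧
      Nat.card {i // Nonempty (A i ≃ₗ[R] R)} = a) ∧
  ∀ b : ℕ, (∃ f : M →ₗ[R] (Fin b → R), Function.Surjective f) → b ≤ a

/-- `s` is the F-signature of the ring `R` of characteristic `p` (with perfect coefficient field):
`R` has finite Krull dimension `d`, each `F^e_* R` has a free rank `a_e`, and
`a_e / p ^ (e d)` tends to `s`. -/
def HasFSignature (p : ℕ) (R : Type*) [CommRing R] [ExpChar R p] (s : ℝ) : Prop :=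
  ∃ d : ℕ, ringKrullDim R = d ∧ ∃ a : ℕ → ℕ,
    (∀ e, IsFreeRank R (FrobeniusPushforward p e R) (a e)) ∧
    Filter.Tendsto (fun e => (a e : ℝ) / (p : ℝ) ^ (e * d)) Filter.atTop (nhds s)

/-! ### Cones and affine toric varieties

`N` is a lattice, `N_ℝ = ℝ ⊗ N`, `M = Hom(N, ℤ)` and `M_ℝ = Hom(N_ℝ, ℝ)`. -/

/-- The real vector space `N_ℝ` of a lattice `N`. -/
abbrev LatticeReal (N : Type*) [AddCommGroup N] : Type _ := ℝ ⊗[ℤ] N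

/-- The image of a lattice vector in `N_ℝ`. -/
def latticeVec {N : Type*} [AddCommGroup N] (v : N) : LatticeReal N := (1 : ℝ) ⊗ₜ[ℤ] v

section Toric

variable {N : Type*} [AddCommGroup N]

/-- Strongly convex rational polyhedral cones in `N_ℝ`. -/
structure IsToricCone (σ : PointedCone ℝ (LatticeReal N)) : Prop where
  rational_polyhedral : ∃ T : Finset N, σ = PointedCone.hull ℝ (latticeVec '' (T : Set N))
  strongly_convex : ∀ x ∈ σ, -x ∈ σ → x = 0

/-- `σ` spans `N_ℝ`; equivalently its toric variety has no torus factors. -/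
def IsFullDimensional (σ : PointedCone ℝ (LatticeReal N)) : Prop :=
  Submodule.span ℝ (σ : Set (LatticeReal N)) = ⊤

/-- The primitive generators of `σ`: the lattice vectors `v` that span an edge (a one-dimensional
face) of `σ` and are not a proper multiple of a lattice vector. -/
def primitiveGenerators (σ : PointedCone ℝ (LatticeReal N)) : Set N :=
  {v | (∀ (c : ℕ) (w : N), v = c • w → c = 1) ∧
    (PointedCone.hull ℝ {latticeVec v}).IsFaceOf σ}

/-- The dual cone `σ^∨` in `M_ℝ`. -/
def dualCone (σ : PointedCone ℝ (LatticeReal N)) :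
    PointedCone ℝ (Module.Dual ℝ (LatticeReal N)) :=
  PointedCone.dual (Module.Dual.eval ℝ (LatticeReal N)) σ

/-- The semigroup `S = σ^∨ ∩ M`. -/
def toricMonoid (σ : PointedCone ℝ (LatticeReal N)) : AddSubmonoid (Module.Dual ℤ N) :=
  (dualCone σ).toAddSubmonoid.comap (Module.Dual.baseChange (R := ℤ) (V := N) ℝ).toAddMonoidHom

/-- The coordinate ring `k[σ^∨ ∩ M]` of the affine toric variety of `σ`. -/
abbrev ToricRing (k : Type*) [Field k] (σ : PointedCone ℝ (LatticeReal N)) : Type _ :=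
  AddMonoidAlgebra k (toricMonoid σ)

/-- The polytope `P_σ = {w ∈ M_ℝ | 0 ≤ w · v < 1 for all primitive generators v of σ}`. -/
def toricPolytope (σ : PointedCone ℝ (LatticeReal N)) : Set (Module.Dual ℝ (LatticeReal N)) :=
  {w | ∀ v ∈ primitiveGenerators σ, 0 ≤ w (latticeVec v) ∧ w (latticeVec v) < 1}

/-- The volume on `M_ℝ` relative to the lattice `M`: Lebesgue measure in the coordinates given by
a basis of `M` (here the dual basis of a basis `b` of `N`, so that the coordinates of `w` are
`w (b i)`). It does not depend on the basis. -/
def latticeVolume [Module.Free ℤ N] [Module.Finite ℤ N]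
    (P : Set (Module.Dual ℝ (LatticeReal N))) : ENNReal :=
  MeasureTheory.volume
    ((fun (w : Module.Dual ℝ (LatticeReal N)) (i : Module.Free.ChooseBasisIndex ℤ N) =>
      w (latticeVec (Module.Free.chooseBasis ℤ N i))) '' P)

/-- The lattice `N' = N ∩ N'_ℝ`, where `N'_ℝ` is the span of `σ`. -/
def spanLattice (σ : PointedCone ℝ (LatticeReal N)) : Submodule ℤ N :=
  AddSubgroup.toIntSubmodule
    ((Submodule.span ℝ (σ : Set (LatticeReal N))).toAddSubgroup.comap
      (AddMonoidHom.mk' latticeVec fun v w => TensorProduct.tmul_add 1 v w))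

/-- The cone `σ'`, that is `σ` viewed as a cone in `N'_ℝ`. -/
def spanCone (σ : PointedCone ℝ (LatticeReal N)) :
    PointedCone ℝ (LatticeReal (spanLattice σ)) :=
  PointedCone.comap ((spanLattice σ).subtype.baseChange ℝ) σ

end Toric

instance {k A : Type*} [Field k] [AddCommMonoid A] (p : ℕ) [ExpChar k p] :
    ExpChar (AddMonoidAlgebra k A) p :=
  expChar_of_injective_algebraMap (algebraMap k (AddMonoidAlgebra k A)).injective p

end

/-! Write `S = σ^∨ ∩ M`, `R = k[S]`, `q = p^e`. Scalars act on `F^e_* R` through `q`-th powers, so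
they preserve exponents modulo `q`, and `F^e_* R` is the direct sum over `c ∈ M/qM` of the span of
the monomials with exponent in `c`. Each piece is indecomposable: for nonzero `x, y` in one piece,
`y^(q-1) x` is a `q`-th power `s^q` (`k` is perfect, `S` saturated), so `y • x = s • y` is a common
nonzero multiple. A piece is isomorphic to `R` exactly when its class has a representative `m₀ ∈ S`
with `S ∩ c ⊆ m₀ + S`; call such a class free. For the maximality of the count, compose a surjection
onto `R^b` with the character `R → k` that kills the non-unit monomials: only the free classes
survive, each giving one vector, and these span `k^b` (`isFreeRank_pushforward`).

For a full-dimensional cone, free classes correspond to the lattice points with `0 ≤ m · v_i < q`,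
that is to the points of `q⁻¹ M` in `P_σ` (`IsToricCone.isFreeClass_iff`,
`IsToricCone.freeClassCount_eq`, `card_latticePoints`). Since `dim R = rank M`
(`ringKrullDim_semigroupRing`), their number divided by `q^d` is a Riemann sum for the volume.

A factor `ℤ^r` multiplies the number of free classes by `q^r` and raises the dimension by `r`, so
the signature is unchanged. As `N ∩ span σ` is a direct summand of `N`, every `S` is such a product.
The signature is unique and invariant under ring isomorphism, which handles an arbitrary `X'`. -/

noncomputable section

/-! ### The Frobenius pushforward of an affine semigroup ring -/

namespace FrobeniusPushforward

/-- The identity map from `R` to `F^e_* R`. -/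
def of (p e : ℕ) (R : Type*) [CommRing R] : R ≃+ FrobeniusPushforward p e R := AddEquiv.refl R

variable {p e : ℕ} {R : Type*} [CommRing R] [ExpChar R p]

theorem smul_of (r x : R) : r • of p e R x = of p e R (r ^ p ^ e * x) := rfl

end FrobeniusPushforward

open FrobeniusPushforward AddMonoidAlgebra

/-- A submonoid `S` of an abelian group `M` is saturated and contains an interior element. -/
structure AddSubmonoid.IsFullSaturated {M : Type*} [AddCommGroup M] (S : AddSubmonoid M) :
    Prop where
  saturated : ∀ (n : ℕ) (m : M), n ≠ 0 → n • m ∈ S → m ∈ S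
  exists_interior : ∃ s ∈ S, ∀ m : M, ∃ K : ℕ, m + K • s ∈ S

theorem AddSubmonoid.IsFullSaturated.exists_sub {M : Type*} [AddCommGroup M] {S : AddSubmonoid M}
    (hS : S.IsFullSaturated) (m : M) : ∃ s ∈ S, ∃ t ∈ S, m = s - t := by
  obtain ⟨s, hs, h⟩ := hS.exists_interior
  obtain ⟨K, hK⟩ := h m
  exact ⟨_, hK, K • s, S.nsmul_mem hs K, by abel⟩

/-! ### Free classes and the free rank of `F^e_* k[S]`. -/

section FreeRank

variable {p e : ℕ} {k : Type*} [Field k]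
variable {M : Type*} [AddCommGroup M] {S : AddSubmonoid M} {G : Type*} [AddCommGroup G]

theorem single_pow_mul_single (t m : S) (a b : k) :
    (single t a : AddMonoidAlgebra k S) ^ p ^ e * single m b =
      single (p ^ e • t + m) (a ^ p ^ e * b) := by
  rw [single_pow, single_mul_single]

theorem of_eq_sum (x : AddMonoidAlgebra k S) :
    of p e _ x = ∑ m ∈ x.coeff.support, of p e _ (single m (x.coeff m)) := by
  conv_lhs => rw [← sum_coeff_single x, Finsupp.sum, map_sum]

variable [ExpChar k p]

/-- The `c`-graded piece of `F^e_* k[S]`, for a grading `π` that kills multiples of `p ^ e`. -/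
def pushforwardGrade (p e : ℕ) [ExpChar k p] (π : M →+ G) (hπ : ∀ m, π (p ^ e • m) = 0) (c : G) :
    Submodule (AddMonoidAlgebra k S) (FrobeniusPushforward p e (AddMonoidAlgebra k S)) where
  carrier := {x | (of p e _).symm x ∈ gradeBy k (π.comp S.subtype) c}
  zero_mem' := (gradeBy k (π.comp S.subtype) c).zero_mem
  add_mem' := (gradeBy k (π.comp S.subtype) c).add_mem
  smul_mem' r x hx := by
    -- Frobenius is additive, so monomials suffice, and their exponents become multiples of `p ^ e`,
    -- of degree `0`.
    have h0 : r ^ p ^ e ∈ gradeBy k (π.comp S.subtype) 0 := by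
      induction r using AddMonoidAlgebra.induction_linear with
      | zero => rw [zero_pow (pow_pos (expChar_pos k p) e).ne']; exact Submodule.zero_mem _
      | add f g hf hg => rw [add_pow_expChar_pow]; exact Submodule.add_mem _ hf hg
      | single m a =>
        rw [single_pow]
        have := single_mem_gradeBy (π.comp S.subtype) (p ^ e • m) (a ^ p ^ e)
        rwa [show (π.comp S.subtype) (p ^ e • m) = 0 by simpa using hπ m] at this
    have := SetLike.mul_mem_graded (A := gradeBy k (π.comp S.subtype)) h0 hx
    rwa [zero_add] at this

variable {π : M →+ G} {hπ : ∀ m, π (p ^ e • m) = 0} {c : G}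

theorem of_mem_pushforwardGrade {x : AddMonoidAlgebra k S} :
    of p e _ x ∈ pushforwardGrade (S := S) p e π hπ c ↔
      ∀ m ∈ x.coeff.support, π m = c := Iff.rfl

theorem of_single_mem_pushforwardGrade {m : S} {a : k} (h : π m = c) :
    of p e _ (single m a) ∈ pushforwardGrade (S := S) p e π hπ c := by
  subst h
  exact single_mem_gradeBy (π.comp S.subtype) m a

theorem pushforwardGrade_isInternal [DecidableEq G] :
    DirectSum.IsInternal (pushforwardGrade (k := k) (S := S) p e π hπ) :=
  gradeBy.isInternal (R := k) (π.comp S.subtype)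

/-- Elements of `k[S]` supported in `p ^ e S` are `p ^ e`-th powers when `k` is perfect. -/
theorem exists_pow_eq_of_support [PerfectRing k p] (x : AddMonoidAlgebra k S)
    (hx : ∀ m ∈ x.coeff.support, ∃ u : S, m = p ^ e • u) : ∃ y, y ^ p ^ e = x := by
  suffices h : x ∈ (iterateFrobenius (AddMonoidAlgebra k S) p e).range by
    obtain ⟨y, hy⟩ := h
    exact ⟨y, by rw [← hy, iterateFrobenius_def]⟩
  rw [← sum_coeff_single x]
  refine Subring.sum_mem _ fun m hm => ?_
  obtain ⟨u, rfl⟩ := hx m hm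
  obtain ⟨a, ha⟩ := (bijective_iterateFrobenius k p e).2 (x.coeff (p ^ e • u))
  refine ⟨single u a, ?_⟩
  rw [iterateFrobenius_def] at ha ⊢
  rw [single_pow, ha]

variable (S π) in
/-- The class `c` has a smallest representative in `S`. -/
def IsFreeClass (c : G) : Prop := ∃ m₀ ∈ S, π m₀ = c ∧ ∀ m ∈ S, π m = c → m - m₀ ∈ S

/-- The character of `k[S]` that sends a monomial to `1` if it is a unit and to `0` otherwise. -/
def unitCharacter (k : Type*) [Field k] (S : AddSubmonoid M) : AddMonoidAlgebra k S →ₐ[k] k := by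
  classical
  exact AddMonoidAlgebra.lift k k S
    { toFun := fun s => if -(s.toAdd : M) ∈ S then 1 else 0
      map_one' := by simp
      map_mul' := fun s t => by
        by_cases h : -(s.toAdd : M) ∈ S <;> by_cases h' : -(t.toAdd : M) ∈ S
        · have : -((s.toAdd : M) + t.toAdd) ∈ S := by
            rw [neg_add]; exact S.add_mem h h'
          simp [h, h', -neg_add_rev, this]
        · have : -((s.toAdd : M) + t.toAdd) ∉ S := fun h1 => h' <| by
            simpa using S.add_mem h1 s.toAdd.2
          simp [h', -neg_add_rev, this]
        all_goals
          have : -((s.toAdd : M) + t.toAdd) ∉ S := fun h1 => h <| by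
            simpa using S.add_mem h1 t.toAdd.2
          simp [h, -neg_add_rev, this] }

theorem exists_unit_of_unitCharacter_ne_zero {y : AddMonoidAlgebra k S}
    (h : unitCharacter k S y ≠ 0) : ∃ u : S, y.coeff u ≠ 0 ∧ -(u : M) ∈ S := by
  classical
  contrapose! h
  rw [unitCharacter, AddMonoidAlgebra.lift_apply]
  refine Finset.sum_eq_zero fun u hu => ?_
  have : -(u : M) ∉ S := h u (Finsupp.mem_support_iff.1 hu)
  simp [this]

/-- Write `m - m₀ = p^e (s - t)` with `s, t ∈ S`. In the pushforward `x^t • x^m = x^s • x^{m₀}`,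
hence `x^t φ(x^m) = x^s φ(x^{m₀})`. If `φ(x^{m₀})` contains a unit monomial `x^u`, the exponent `s +
u` occurs on the left, so it lies in `t + S`; as `u` is invertible, `s - t ∈ S`. -/
theorem sub_mem_of_unitCharacter_ne_zero (hS : S.IsFullSaturated)
    (hker : ∀ m, π m = 0 → ∃ u, m = p ^ e • u)
    (φ : pushforwardGrade (k := k) (S := S) p e π hπ c →ₗ[AddMonoidAlgebra k S]
      AddMonoidAlgebra k S) {m₀ m : S} (h₀ : π m₀ = c) (h : π m = c)
    (hφ : unitCharacter k S (φ ⟨_, of_single_mem_pushforwardGrade (a := 1) h₀⟩) ≠ 0) :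
    (m - m₀ : M) ∈ S := by
  obtain ⟨u, hu, hu'⟩ := exists_unit_of_unitCharacter_ne_zero hφ
  obtain ⟨v, hv⟩ := hker (m - m₀ : M) (by rw [map_sub, h, h₀, sub_self])
  obtain ⟨s, hs, t, ht, rfl⟩ := hS.exists_sub v
  have key : (single (⟨t, ht⟩ : S) 1 : AddMonoidAlgebra k S) •
      φ ⟨_, of_single_mem_pushforwardGrade (a := 1) h⟩ =
      (single (⟨s, hs⟩ : S) 1 : AddMonoidAlgebra k S) •
      φ ⟨_, of_single_mem_pushforwardGrade (a := 1) h₀⟩ := by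
    rw [← map_smul, ← map_smul]
    congr 1
    apply Subtype.ext
    simp only [Submodule.coe_smul, smul_of, single_pow_mul_single]
    congr 2
    apply Subtype.ext
    have : (m : M) = m₀ + p ^ e • (s - t) := by rw [← hv]; abel
    simp only [AddSubmonoid.coe_add, AddSubmonoidClass.coe_nsmul, this, smul_sub]
    abel
  have h1 := congrArg (fun z : AddMonoidAlgebra k S => z.coeff (⟨s, hs⟩ + u)) key
  simp only [smul_eq_mul, coeff_single_mul_add, one_mul] at h1
  rw [← h1] at hu
  have : ∃ w : S, (⟨t, ht⟩ : S) + w = ⟨s, hs⟩ + u := by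
    by_contra! hne
    exact hu (coeff_single_mul_of_forall_add_ne _ _ hne)
  obtain ⟨w, hw⟩ := this
  have hw' : t + w = s + u := congrArg Subtype.val hw
  have : s - t = w + -(u : M) := by
    rw [← sub_eq_add_neg, sub_eq_sub_iff_add_eq_add, ← hw', add_comm]
  rw [hv, this]
  exact S.nsmul_mem (S.add_mem w.2 hu') _

/-- Perfectness provides a `p^e`-th root of the coefficient, which makes it a scalar. -/
theorem of_single_eq_smul [PerfectRing k p] (m : S) (a : k) :
    ∃ μ : k, of p e _ (single m a) =
      (single 0 μ : AddMonoidAlgebra k S) • of p e _ (single m 1) := by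
  obtain ⟨μ, hμ⟩ := (bijective_iterateFrobenius k p e).2 a
  rw [iterateFrobenius_def] at hμ
  exact ⟨μ, by rw [smul_of, single_pow_mul_single, hμ]; simp⟩

/-- A linear form on a graded piece that does not vanish under the unit character forces the class
to be free. -/
theorem isFreeClass_of_unitCharacter_ne_zero [PerfectRing k p] (hS : S.IsFullSaturated)
    (hker : ∀ m, π m = 0 → ∃ u, m = p ^ e • u)
    (φ : pushforwardGrade (k := k) (S := S) p e π hπ c →ₗ[AddMonoidAlgebra k S]
      AddMonoidAlgebra k S) (x) (hφ : unitCharacter k S (φ x) ≠ 0) : IsFreeClass S π c := by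
  by_contra hc
  apply hφ
  obtain ⟨x, hx⟩ := x
  obtain ⟨x, rfl⟩ := (of p e _).surjective x
  have hsum : (⟨_, hx⟩ : pushforwardGrade (k := k) (S := S) p e π hπ c) =
      ∑ m ∈ x.coeff.support.attach, ⟨of p e _ (single m.1 (x.coeff m.1)),
        of_single_mem_pushforwardGrade (of_mem_pushforwardGrade.1 hx m.1 m.2)⟩ := by
    apply Subtype.ext
    rw [AddSubmonoidClass.coe_finsetSum]
    exact (of_eq_sum x).trans (Finset.sum_attach _ fun m => of p e _ (single m (x.coeff m))).symm
  rw [hsum, map_sum, map_sum]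
  refine Finset.sum_eq_zero fun m _ => ?_
  have hm := of_mem_pushforwardGrade.1 hx m.1 m.2
  obtain ⟨μ, hμ⟩ := of_single_eq_smul (p := p) (e := e) m.1 (x.coeff m.1)
  have : (⟨of p e _ (single m.1 (x.coeff m.1)), of_single_mem_pushforwardGrade hm⟩ :
      pushforwardGrade (k := k) (S := S) p e π hπ c) = (single 0 μ : AddMonoidAlgebra k S) •
      ⟨_, of_single_mem_pushforwardGrade (a := 1) hm⟩ := Subtype.ext hμ
  rw [this, map_smul, smul_eq_mul, map_mul]
  refine mul_eq_zero_of_right _ ?_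
  -- A monomial not killed by `φ` followed by the character would be a smallest representative of
  -- `c`.
  by_contra hne
  exact hc ⟨m.1, m.1.2, hm, fun m' hm' hc' =>
    sub_mem_of_unitCharacter_ne_zero hS hker φ (m := ⟨m', hm'⟩) hm hc' hne⟩

theorem of_single_mem_span_of_isFreeClass [PerfectRing k p] (hS : S.IsFullSaturated)
    (hker : ∀ m, π m = 0 → ∃ u, m = p ^ e • u) {m₀ m : S} (hm : π m = π m₀)
    (h : (m - m₀ : M) ∈ S) (a : k) :
    ∃ (u : S) (μ : k), of p e _ (single m a) =
      (single u μ : AddMonoidAlgebra k S) • of p e _ (single m₀ 1) := by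
  obtain ⟨u, hu⟩ := hker (m - m₀ : M) (by rw [map_sub, hm, sub_self])
  have huS : u ∈ S := hS.saturated (p ^ e) u (pow_pos (expChar_pos k p) e).ne' (hu ▸ h)
  obtain ⟨μ, hμ⟩ := (bijective_iterateFrobenius k p e).2 a
  rw [iterateFrobenius_def] at hμ
  refine ⟨⟨u, huS⟩, μ, ?_⟩
  rw [smul_of, single_pow_mul_single, hμ, mul_one]
  congr 2
  apply Subtype.ext
  simp [← hu]

/-- An isomorphism attains the value `1`, on which the unit character does not vanish. Conversely
the smallest monomial generates the piece, with no annihilator because `k[S]` is a domain. -/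
theorem nonempty_linearEquiv_iff_isFreeClass [PerfectRing k p] [IsDomain (AddMonoidAlgebra k S)]
    (hS : S.IsFullSaturated) (hker : ∀ m, π m = 0 → ∃ u, m = p ^ e • u) :
    Nonempty (pushforwardGrade (k := k) (S := S) p e π hπ c ≃ₗ[AddMonoidAlgebra k S]
      AddMonoidAlgebra k S) ↔ IsFreeClass S π c := by
  refine ⟨fun ⟨ψ⟩ => isFreeClass_of_unitCharacter_ne_zero hS hker ψ.toLinearMap (ψ.symm 1)
    (by simp), fun ⟨m₀, hm₀, hc, hmin⟩ => ?_⟩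
  set g : pushforwardGrade (k := k) (S := S) p e π hπ c :=
    ⟨of p e _ (single ⟨m₀, hm₀⟩ 1), of_single_mem_pushforwardGrade hc⟩ with hg
  refine ⟨(LinearEquiv.ofBijective (LinearMap.toSpanSingleton (AddMonoidAlgebra k S) _ g)
    ⟨?_, ?_⟩).symm⟩
  · rw [injective_iff_map_eq_zero]
    intro r hr
    have h1 : r ^ p ^ e * single ⟨m₀, hm₀⟩ 1 = 0 :=
      (of p e _).injective (congrArg Subtype.val hr)
    rcases mul_eq_zero.1 h1 with h | h
    · exact eq_zero_of_pow_eq_zero h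
    · simp at h
  · rintro ⟨x, hx⟩
    obtain ⟨x, rfl⟩ := (of p e _).surjective x
    have : of p e _ x ∈ Submodule.span (AddMonoidAlgebra k S) {g.1} := by
      rw [of_eq_sum]
      refine Submodule.sum_mem _ fun m hm => ?_
      have hmc := of_mem_pushforwardGrade.1 hx m hm
      obtain ⟨u, μ, h⟩ := of_single_mem_span_of_isFreeClass (k := k) (m₀ := ⟨m₀, hm₀⟩) hS hker
        (hmc.trans hc.symm) (hmin m m.2 hmc) (x.coeff m)
      rw [h]
      exact Submodule.smul_mem _ _ (Submodule.mem_span_singleton_self _)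
    obtain ⟨r, hr⟩ := Submodule.mem_span_singleton.1 this
    exact ⟨r, Subtype.ext hr⟩

/-- Nonzero elements of two complementary submodules would have a nonzero multiple in the
intersection. -/
theorem isIndecomposableModule_of_common_multiple {R A : Type*} [CommRing R] [AddCommGroup A]
    [Module R A] [Nontrivial A]
    (h : ∀ x y : A, x ≠ 0 → y ≠ 0 → ∃ r s : R, r • x = s • y ∧ r • x ≠ 0) :
    IsIndecomposableModule R A := by
  refine ⟨inferInstance, fun B C hBC => ?_⟩
  by_contra! hne
  obtain ⟨x, hx, hx0⟩ := Submodule.exists_mem_ne_zero_of_ne_bot hne.1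
  obtain ⟨y, hy, hy0⟩ := Submodule.exists_mem_ne_zero_of_ne_bot hne.2
  obtain ⟨r, s, hrs, h0⟩ := h x y hx0 hy0
  exact h0 (Submodule.disjoint_def.1 hBC.disjoint _ (B.smul_mem r hx) (hrs ▸ C.smul_mem s hy))

theorem pushforwardGrade_isIndecomposable [PerfectRing k p] [IsDomain (AddMonoidAlgebra k S)]
    (hS : S.IsFullSaturated) (hker : ∀ m, π m = 0 → ∃ u, m = p ^ e • u)
    (hsurj : Function.Surjective π) :
    IsIndecomposableModule (AddMonoidAlgebra k S)
      (pushforwardGrade (k := k) (S := S) p e π hπ c) := by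
  have hq : p ^ e ≠ 0 := (pow_pos (expChar_pos k p) e).ne'
  have : Nontrivial (pushforwardGrade (k := k) (S := S) p e π hπ c) := by
    obtain ⟨m, rfl⟩ := hsurj c
    obtain ⟨s, hs, h⟩ := hS.exists_interior
    obtain ⟨K, hK⟩ := h m
    -- Adding a multiple of `p ^ e` keeps the class; the sum is `(m + K s) + (p^e - 1) K s`, with
    -- both terms in `S`.
    have hmem : m + p ^ e • (K • s) ∈ S := by
      obtain ⟨n, hn⟩ := Nat.exists_eq_succ_of_ne_zero hq
      rw [hn, succ_nsmul', ← add_assoc]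
      exact S.add_mem hK (S.nsmul_mem (S.nsmul_mem hs _) _)
    refine ⟨⟨⟨of p e _ (single ⟨_, hmem⟩ 1), of_single_mem_pushforwardGrade ?_⟩, 0, ?_⟩⟩
    · rw [map_add, hπ, add_zero]
    · intro h0
      have h1 : (single (⟨_, hmem⟩ : S) 1 : AddMonoidAlgebra k S) = 0 :=
        (of p e _).injective (congrArg Subtype.val h0)
      simp at h1
  refine isIndecomposableModule_of_common_multiple ?_
  rintro ⟨x, hx⟩ ⟨y, hy⟩ hx0 hy0
  obtain ⟨x, rfl⟩ := (of p e _).surjective x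
  obtain ⟨y, rfl⟩ := (of p e _).surjective y
  have hx0 : x ≠ 0 := by rintro rfl; exact hx0 (Subtype.ext (map_zero _))
  have hy0 : y ≠ 0 := by rintro rfl; exact hy0 (Subtype.ext (map_zero _))
  have hqc : p ^ e • c = 0 := by
    obtain ⟨m, rfl⟩ := hsurj c
    rw [← map_nsmul, hπ]
  -- The degree is `p^e c = 0`, so all exponents are divisible by `p ^ e` and the product is a
  -- `p^e`-th power.
  have hgr : y ^ (p ^ e - 1) * x ∈ gradeBy k (π.comp S.subtype) ((p ^ e - 1) • c + c) :=
    SetLike.mul_mem_graded (SetLike.pow_mem_graded _ hy) hx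
  rw [← succ_nsmul, Nat.sub_one_add_one hq, hqc] at hgr
  obtain ⟨s, hs⟩ := exists_pow_eq_of_support (p := p) (e := e) (y ^ (p ^ e - 1) * x) fun m hm => by
    obtain ⟨u, hu⟩ := hker m (hgr m hm)
    exact ⟨⟨u, hS.saturated _ u hq (hu ▸ m.2)⟩, Subtype.ext hu⟩
  have hyx : y ^ p ^ e * x = s ^ p ^ e * y := by
    rw [hs, ← Nat.sub_one_add_one hq, pow_succ, Nat.sub_one_add_one hq]; ring
  refine ⟨y, s, Subtype.ext ?_, fun h => ?_⟩
  · exact congrArg (of p e _) hyx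
  · exact mul_ne_zero (pow_ne_zero _ hy0) hx0 ((of p e _).injective (congrArg Subtype.val h))

theorem unitCharacter_eq_zero_of_not_isFreeClass [PerfectRing k p] (hS : S.IsFullSaturated)
    (hπ : ∀ m, π (p ^ e • m) = 0) (hker : ∀ m, π m = 0 → ∃ u, m = p ^ e • u)
    (ψ : FrobeniusPushforward p e (AddMonoidAlgebra k S) →ₗ[AddMonoidAlgebra k S]
      AddMonoidAlgebra k S) {m : S} (hm : ¬ IsFreeClass S π (π m)) (a : k) :
    unitCharacter k S (ψ (of p e _ (single m a))) = 0 := by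
  by_contra hne
  exact hm (isFreeClass_of_unitCharacter_ne_zero hS hker
    (ψ ∘ₗ (pushforwardGrade p e π hπ (π m)).subtype) ⟨_, of_single_mem_pushforwardGrade rfl⟩ hne)

/-- After the unit character is applied in each coordinate, monomials of non-free classes vanish and
those of a free class become multiples of the image of its smallest one. So `k^b` is spanned by one
vector per free class. -/
theorem le_card_isFreeClass_of_surjective [PerfectRing k p] [Finite G] (hS : S.IsFullSaturated)
    (hπ : ∀ m, π (p ^ e • m) = 0) (hker : ∀ m, π m = 0 → ∃ u, m = p ^ e • u) {b : ℕ}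
    (f : FrobeniusPushforward p e (AddMonoidAlgebra k S) →ₗ[AddMonoidAlgebra k S]
      (Fin b → AddMonoidAlgebra k S)) (hf : Function.Surjective f) :
    b ≤ Nat.card {c // IsFreeClass S π c} := by
  have := Fintype.ofFinite {c // IsFreeClass S π c}
  choose m₀ hm₀ hc hmin using fun c : {c // IsFreeClass S π c} => c.2
  let ε : (Fin b → AddMonoidAlgebra k S) →+ (Fin b → k) :=
    (unitCharacter k S).toRingHom.toAddMonoidHom.compLeft (Fin b)
  have hε (x) (i) : ε x i = unitCharacter k S (x i) := rfl
  let w : {c // IsFreeClass S π c} → (Fin b → k) :=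
    fun c => ε (f (of p e _ (single ⟨m₀ c, hm₀ c⟩ 1)))
  have hspan : Submodule.span k (Set.range w) = ⊤ := by
    rw [eq_top_iff]
    rintro y -
    obtain ⟨x, hx⟩ := hf (fun i => algebraMap k _ (y i))
    obtain ⟨x, rfl⟩ := (of p e _).surjective x
    have hy : y = ε (f (of p e _ x)) := by
      rw [hx]; ext i; rw [hε, AlgHom.commutes]; rfl
    rw [hy, of_eq_sum, map_sum, map_sum]
    refine Submodule.sum_mem _ fun m _ => ?_
    by_cases hfree : IsFreeClass S π (π m)
    · obtain ⟨u, μ, h⟩ := of_single_mem_span_of_isFreeClass (k := k)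
        (m₀ := ⟨m₀ ⟨_, hfree⟩, hm₀ _⟩) hS hker (hc ⟨_, hfree⟩).symm
        (hmin ⟨_, hfree⟩ m m.2 rfl) (x.coeff m)
      have : ε (f (of p e _ (single m (x.coeff m)))) =
          unitCharacter k S (single u μ) • w ⟨_, hfree⟩ := by
        rw [h, map_smul]
        ext i
        simp [hε, w]
      rw [this]
      exact Submodule.smul_mem _ _ (Submodule.subset_span ⟨_, rfl⟩)
    · have : ε (f (of p e _ (single m (x.coeff m)))) = 0 := by
        ext i
        exact unitCharacter_eq_zero_of_not_isFreeClass hS hπ hker (LinearMap.proj i ∘ₗ f) hfree _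
      rw [this]
      exact Submodule.zero_mem _
  have := finrank_range_le_card (R := k) w
  rwa [Set.finrank, hspan, finrank_top, Module.finrank_fin_fun, ← Nat.card_eq_fintype_card] at this

/-- The free rank of `F^e_* k[S]` is the number of free classes modulo `p ^ e`. -/
theorem isFreeRank_pushforward [PerfectRing k p] [Finite G] [IsDomain (AddMonoidAlgebra k S)]
    (hS : S.IsFullSaturated) (hπ : ∀ m, π (p ^ e • m) = 0)
    (hker : ∀ m, π m = 0 → ∃ u, m = p ^ e • u) (hsurj : Function.Surjective π) :
    IsFreeRank (AddMonoidAlgebra k S) (FrobeniusPushforward p e (AddMonoidAlgebra k S))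
      (Nat.card {c // IsFreeClass S π c}) := by
  classical
  refine ⟨⟨Nat.card G, fun i => pushforwardGrade p e π hπ ((Finite.equivFin G).symm i), ?_, ?_, ?_⟩,
    fun b ⟨f, hf⟩ => le_card_isFreeClass_of_surjective hS hπ hker f hf⟩
  · have h := (DirectSum.isInternal_submodule_iff_iSupIndep_and_iSup_eq_top _).1
      (pushforwardGrade_isInternal (k := k) (S := S) (hπ := hπ))
    refine (DirectSum.isInternal_submodule_iff_iSupIndep_and_iSup_eq_top _).2
      ⟨h.1.comp (Finite.equivFin G).symm.injective, ?_⟩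
    rw [← h.2]
    exact (Finite.equivFin G).symm.iSup_comp
  · exact fun i => pushforwardGrade_isIndecomposable hS hker hsurj
  · exact Nat.card_congr ((Finite.equivFin G).symm.subtypeEquiv fun i =>
      nonempty_linearEquiv_iff_isFreeClass hS hker)

end FreeRank

end

noncomputable section

open AddMonoidAlgebra

/-! ### The Krull dimension of an affine semigroup ring -/

section KrullDim

theorem exists_algebraicIndependent_lift {k A B : Type*} [Field k] [CommRing A]
    [CommRing B] [Algebra k A] [Algebra k B] (f : A →ₐ[k] B) (hf : Function.Surjective f)
    {ι : Type*} {y : ι → B} (hy : AlgebraicIndependent k y) :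
    ∃ z : ι → A, AlgebraicIndependent k z ∧ ∀ i, f (z i) = y i := by
  choose g hg using hf
  refine ⟨fun i => g (y i), AlgebraicIndependent.of_comp f ?_, fun i => hg _⟩
  convert hy using 1
  ext i
  exact hg _

/-- A proper quotient of a domain has fewer algebraically independent elements. -/
theorem exists_algebraicIndependent_succ {k A B : Type*} [Field k] [CommRing A] [IsDomain A]
    [CommRing B] [Algebra k A] [Algebra k B] (f : A →ₐ[k] B) (hf : Function.Surjective f)
    {x : A} (hx0 : x ≠ 0) (hx : f x = 0) {n : ℕ} {y : Fin n → B} (hy : AlgebraicIndependent k y) :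
    ∃ z : Fin (n + 1) → A, AlgebraicIndependent k z := by
  obtain ⟨z, hz, hzy⟩ := exists_algebraicIndependent_lift f hf hy
  -- If `x` were algebraic over `k[z]`, the kernel of `f` would contain a nonzero `P(z)`; then `P(y)
  -- = 0` contradicts the independence of `y`.
  have htr : Transcendental (Algebra.adjoin k (Set.range z)) x := by
    intro halg
    refine Ideal.comap_ne_bot_of_algebraic_mem (I := RingHom.ker f) hx0 hx halg ?_
    rw [eq_bot_iff]
    intro a ha
    have ha : f a = 0 := ha
    obtain ⟨P, hP⟩ : ∃ P : MvPolynomial (Fin n) k, MvPolynomial.aeval z P = a.1 :=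
      (Algebra.adjoin_range_eq_range_aeval k z).le a.2
    rw [← hP, MvPolynomial.comp_aeval_apply, funext hzy] at ha
    have hP0 : P = 0 := (algebraicIndependent_iff.1 hy) P ha
    rw [hP0, map_zero] at hP
    exact Subtype.ext hP.symm
  have := (hz.option_iff_transcendental x).2 htr
  exact ⟨_, (algebraicIndependent_equiv (finSuccEquiv n)).2 this⟩

/-- Each strict inclusion of primes is a proper quotient of a domain and contributes one more
independent element. -/
theorem exists_algebraicIndependent_of_strictMono {k A : Type*} [Field k] [CommRing A]
    [Algebra k A] {l : ℕ} (f : Fin (l + 1) → PrimeSpectrum A) (hf : StrictMono f) :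
    ∃ z : Fin l → A ⧸ (f 0).asIdeal, AlgebraicIndependent k z := by
  induction l with
  | zero =>
    exact ⟨Fin.elim0, (algebraicIndependent_empty_type_iff).2
      (algebraMap k (A ⧸ (f 0).asIdeal)).injective⟩
  | succ l ih =>
    obtain ⟨y, hy⟩ := ih (fun i => f i.succ) fun i j h => hf (Fin.succ_lt_succ_iff.2 h)
    have hlt : f 0 < f (Fin.succ 0) := hf (Fin.succ_pos 0)
    obtain ⟨x, hx1, hx0⟩ := SetLike.exists_of_lt
      (show (f 0).asIdeal < (f (Fin.succ 0)).asIdeal from hlt)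
    refine exists_algebraicIndependent_succ
      (Ideal.Quotient.factorₐ k (show (f 0).asIdeal ≤ (f (Fin.succ 0)).asIdeal from hlt.le))
      (Ideal.Quotient.factor_surjective hlt.le) (x := Ideal.Quotient.mk _ x) ?_ ?_ hy
    · rwa [Ne, Ideal.Quotient.eq_zero_iff_mem]
    · exact Ideal.Quotient.eq_zero_iff_mem.2 hx1

/-- The Krull dimension is bounded by the transcendence degree. -/
theorem ringKrullDim_le_of_algebraicIndependent (k : Type*) {A : Type*} [Field k] [CommRing A]
    [Algebra k A] (n : ℕ)
    (h : ∀ (l : ℕ) (z : Fin l → A), AlgebraicIndependent k z → l ≤ n) : ringKrullDim A ≤ n := by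
  refine iSup_le fun s => ?_
  obtain ⟨y, hy⟩ := exists_algebraicIndependent_of_strictMono (k := k) s.toFun s.strictMono
  obtain ⟨z, hz, -⟩ := exists_algebraicIndependent_lift
    (Ideal.Quotient.mkₐ k (s.toFun 0).asIdeal) (Ideal.Quotient.mkₐ_surjective _ _) hy
  exact_mod_cast h _ z hz

/-- Unique sums make `k[M]`, and below `k[S]`, a domain. -/
instance uniqueSums_of_free {M : Type*} [AddCommGroup M] [Module.Free ℤ M] : UniqueSums M :=
  UniqueSums.of_injective_addHom
    (Module.Free.chooseBasis ℤ M).repr.toLinearMap.toAddMonoidHom.toAddHom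
    (Module.Free.chooseBasis ℤ M).repr.injective inferInstance

instance uniqueSums_addSubmonoid {M : Type*} [AddCommGroup M] [Module.Free ℤ M]
    (S : AddSubmonoid M) : UniqueSums S :=
  UniqueSums.of_injective_addHom S.subtype.toAddHom Subtype.val_injective inferInstance

variable {k : Type*} [Field k] {M : Type*} [AddCommGroup M]

/-- For `s` interior, `k[M]` arises from `k[S]` by inverting `x^s`: every element lies in `k[S]` up
to the unit `x^{Ks}`. Contraction of primes is therefore strictly monotone. -/
theorem ringKrullDim_group_le_submonoid {S : AddSubmonoid M} (hS : S.IsFullSaturated) :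
    ringKrullDim (AddMonoidAlgebra k M) ≤ ringKrullDim (AddMonoidAlgebra k S) := by
  obtain ⟨s, hs, hgen⟩ := hS.exists_interior
  let ι := mapDomainRingHom k S.subtype
  have key : ∀ x : AddMonoidAlgebra k M, ∃ (K : ℕ) (y : AddMonoidAlgebra k S),
      ι y = single (K • s) 1 * x := by
    intro x
    induction x using AddMonoidAlgebra.induction_linear with
    | zero => exact ⟨0, 0, by simp⟩
    | add f g hf hg =>
      obtain ⟨K, a, ha⟩ := hf
      obtain ⟨L, b, hb⟩ := hg
      refine ⟨K + L, single (L • ⟨s, hs⟩) 1 * a + single (K • ⟨s, hs⟩) 1 * b, ?_⟩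
      rw [map_add, map_mul, map_mul, ha, hb, mul_add, ← mul_assoc, ← mul_assoc]
      simp [ι, single_mul_single, add_smul, add_comm]
    | single m a =>
      obtain ⟨K, hK⟩ := hgen m
      exact ⟨K, single ⟨_, hK⟩ a, by simp [ι, single_mul_single, add_comm]⟩
  have hunit (K : ℕ) : IsUnit (single (K • s) 1 : AddMonoidAlgebra k M) :=
    IsUnit.of_mul_eq_one (single (-(K • s)) 1) (by simp [single_mul_single, one_def])
  refine Order.krullDim_le_of_strictMono (PrimeSpectrum.comap ι) fun P Q hPQ => ?_
  refine lt_of_le_of_ne (Ideal.comap_mono hPQ.le) fun heq => ?_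
  obtain ⟨x, hxQ, hxP⟩ := SetLike.exists_of_lt (show P.asIdeal < Q.asIdeal from hPQ)
  obtain ⟨K, y, hy⟩ := key x
  have hyQ : y ∈ (PrimeSpectrum.comap ι Q).asIdeal := by
    change ι y ∈ Q.asIdeal
    rw [hy]; exact Ideal.mul_mem_left _ _ hxQ
  rw [← heq] at hyQ
  change ι y ∈ P.asIdeal at hyQ
  rw [hy, Ideal.unit_mul_mem_iff_mem _ (hunit K)] at hyQ
  exact hxP hyQ

variable [Module.Free ℤ M]

/-- The `m` for which `x^m` and `x^{-m}` are both algebraic form a subgroup. It contains each basis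
vector `b i`, because the inverse monomial is a root of `x^{b i} T - 1`. -/
theorem isAlgebraic_adjoin_monomials {ι : Type*} (b : Module.Basis ι ℤ M) :
    Algebra.IsAlgebraic (Algebra.adjoin k (Set.range fun i =>
      (single (b i) 1 : AddMonoidAlgebra k M)))
      (AddMonoidAlgebra k M) := by
  set A := Algebra.adjoin k (Set.range fun i => (single (b i) 1 : AddMonoidAlgebra k M))
  let C := Subalgebra.algebraicClosure A (AddMonoidAlgebra k M)
  let H : AddSubgroup M :=
    { carrier := {m | (single m 1 : AddMonoidAlgebra k M) ∈ C ∧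
        (single (-m) 1 : AddMonoidAlgebra k M) ∈ C}
      zero_mem' := by
        rw [Set.mem_ofPred_eq, neg_zero, and_self]; exact C.one_mem
      add_mem' := fun {m n} hm hn => by
        have h1 := C.mul_mem hm.1 hn.1
        have h2 := C.mul_mem hm.2 hn.2
        rw [single_mul_single, one_mul] at h1 h2
        rw [Set.mem_ofPred_eq, neg_add]
        exact ⟨h1, h2⟩
      neg_mem' := fun {m} hm => by
        rw [Set.mem_ofPred_eq, neg_neg]; exact hm.symm }
  have hH : ∀ m, m ∈ H := by
    suffices AddSubgroup.toIntSubmodule H = ⊤ from fun m => by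
      have : m ∈ AddSubgroup.toIntSubmodule H := this ▸ Submodule.mem_top
      exact this
    rw [eq_top_iff, ← b.span_eq, Submodule.span_le]
    rintro _ ⟨i, rfl⟩
    set x : A := ⟨single (b i) 1, Algebra.subset_adjoin ⟨i, rfl⟩⟩
    refine ⟨isAlgebraic_algebraMap x, ?_⟩
    refine ⟨Polynomial.C x * Polynomial.X - 1, fun h0 => ?_, ?_⟩
    · have := congrArg (Polynomial.eval 0) h0
      simp at this
    · simp [x, one_def, Algebra.algebraMap_eq_smul_one, Subalgebra.smul_def]
  refine ⟨fun x => ?_⟩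
  change x ∈ C
  induction x using AddMonoidAlgebra.induction_linear with
  | zero => exact C.zero_mem
  | add f g hf hg => exact C.add_mem hf hg
  | single m a =>
    have h1 : (single m a : AddMonoidAlgebra k M) =
      algebraMap A _ (algebraMap k A a) * single m 1 := by
      rw [← IsScalarTower.algebraMap_apply, AddMonoidAlgebra.coe_algebraMap]
      simp [single_mul_single]
    rw [h1]
    exact C.mul_mem (isAlgebraic_algebraMap _) (hH m).1

variable [Module.Finite ℤ M]

theorem le_finrank_of_algebraicIndependent {l : ℕ} {z : Fin l → AddMonoidAlgebra k M}
    (hz : AlgebraicIndependent k z) : l ≤ Module.finrank ℤ M := by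
  have := isAlgebraic_adjoin_monomials (k := k) (Module.finBasis ℤ M)
  have h1 := Algebra.IsAlgebraic.trdeg_le_cardinalMk k
    (Set.range fun i => (single (Module.finBasis ℤ M i) 1 : AddMonoidAlgebra k M))
  have h2 := hz.lift_cardinalMk_le_trdeg
  have h3 := h2.trans (Cardinal.lift_le.2 h1)
  have h4 := h3.trans Cardinal.mk_range_le_lift
  simpa using h4

/-- Setting one variable equal to `1` kills a nonzerodivisor, so the dimension drops by at least
one. -/
theorem le_ringKrullDim_laurent (k : Type*) [Field k] (n : ℕ) :
    (n : WithBot ℕ∞) ≤ ringKrullDim (AddMonoidAlgebra k (Fin n → ℤ)) := by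
  induction n with
  | zero => exact_mod_cast ringKrullDim_nonneg_of_nontrivial
  | succ n ih =>
    let g : (Fin (n + 1) → ℤ) →+ (Fin n → ℤ) :=
      (LinearMap.funLeft ℤ ℤ (Fin.succ : Fin n → Fin (n + 1))).toAddMonoidHom
    have hg : Function.Surjective g :=
      LinearMap.funLeft_surjective_of_injective ℤ ℤ _ (Fin.succ_injective n)
    have := ringKrullDim_succ_le_of_surjective (mapDomainRingHom k g)
      (r := single (Pi.single 0 1) 1 - 1) ?_ ?_ ?_
    · refine le_trans ?_ this
      push_cast
      gcongr
    · intro x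
      induction x using AddMonoidAlgebra.induction_linear with
      | zero => exact ⟨0, map_zero _⟩
      | add f g hf hg =>
        obtain ⟨a, rfl⟩ := hf
        obtain ⟨b, rfl⟩ := hg
        exact ⟨a + b, map_add _ _ _⟩
      | single m a =>
        obtain ⟨m, rfl⟩ := hg m
        exact ⟨single m a, by simp⟩
    · rw [mem_nonZeroDivisors_iff_ne_zero, sub_ne_zero, one_def, Ne, single_left_inj one_ne_zero]
      intro h
      simpa using congrFun h 0
    · have : g (Pi.single 0 1) = 0 := by
        ext i; simp [g, LinearMap.funLeft_apply]
      rw [map_sub, map_one, sub_eq_zero, mapDomainRingHom_apply, mapDomain_single, this, one_def]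

theorem ringKrullDim_semigroupRing {S : AddSubmonoid M} (hS : S.IsFullSaturated) :
    ringKrullDim (AddMonoidAlgebra k S) = Module.finrank ℤ M := by
  refine le_antisymm (ringKrullDim_le_of_algebraicIndependent k _ fun l z hz => ?_) ?_
  · exact le_finrank_of_algebraicIndependent
      (hz.map' (f := mapDomainAlgHom k k S.subtype) (mapDomain_injective Subtype.val_injective))
  · refine le_trans ?_ (ringKrullDim_group_le_submonoid hS)
    rw [ringKrullDim_eq_of_ringEquiv (domCongr k k
      (Module.finBasis ℤ M).equivFun.toAddEquiv).toRingEquiv]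
    exact le_ringKrullDim_laurent k _

end KrullDim

end

noncomputable section

open scoped DirectSum

open AddMonoidAlgebra FrobeniusPushforward

/-! ### Uniqueness and invariance of the F-signature -/

section Signature

/-- Projecting onto the free summands turns any decomposition into a free quotient; the maximality
clause of `IsFreeRank` then compares two decompositions. -/
theorem exists_surjective_of_isInternal {R M : Type*} [CommRing R] [AddCommGroup M] [Module R M]
    {n : ℕ} {A : Fin n → Submodule R M} (hA : DirectSum.IsInternal A) :
    ∃ f : M →ₗ[R] (Fin (Nat.card {i // Nonempty (A i ≃ₗ[R] R)}) → R), Function.Surjective f := by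
  classical
  let ψ (i : {i // Nonempty (A i ≃ₗ[R] R)}) : A i.1 ≃ₗ[R] R := i.2.some
  let g : (⨁ i, A i) →ₗ[R] ({i // Nonempty (A i ≃ₗ[R] R)} → R) :=
    LinearMap.pi fun i => (ψ i).toLinearMap ∘ₗ DirectSum.component R (Fin n) (fun i => A i) i.1
  have hg : Function.Surjective g := fun y => by
    refine ⟨∑ i, DirectSum.lof R (Fin n) (fun i => A i) i.1 ((ψ i).symm (y i)), ?_⟩
    ext j
    simp only [g, LinearMap.pi_apply, LinearMap.comp_apply, map_sum]
    rw [Finset.sum_eq_single j]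
    · simp [DirectSum.component.lof_self]
    · intro i _ hij
      rw [DirectSum.component.of, dif_neg (fun h => hij (Subtype.ext h))]
      simp
    · simp
  let E : M ≃ₗ[R] ⨁ i, A i := (LinearEquiv.ofBijective (DirectSum.coeLinearMap A) hA).symm
  let F : ({i // Nonempty (A i ≃ₗ[R] R)} → R) ≃ₗ[R]
      (Fin (Nat.card {i // Nonempty (A i ≃ₗ[R] R)}) → R) :=
    LinearEquiv.funCongrLeft R R (Finite.equivFin _).symm
  exact ⟨F.toLinearMap ∘ₗ g ∘ₗ E.toLinearMap, F.surjective.comp (hg.comp E.surjective)⟩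

theorem IsFreeRank.unique {R M : Type*} [CommRing R] [AddCommGroup M] [Module R M] {a b : ℕ}
    (ha : IsFreeRank R M a) (hb : IsFreeRank R M b) : a = b := by
  obtain ⟨⟨n, A, hA, -, hcA⟩, ha⟩ := ha
  obtain ⟨⟨m, B, hB, -, hcB⟩, hb⟩ := hb
  subst hcA hcB
  exact le_antisymm (hb _ (exists_surjective_of_isInternal hA))
    (ha _ (exists_surjective_of_isInternal hB))

theorem HasFSignature.unique {p : ℕ} {R : Type*} [CommRing R] [ExpChar R p] {s t : ℝ}
    (hs : HasFSignature p R s) (ht : HasFSignature p R t) : s = t := by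
  obtain ⟨d, hd, a, ha, hs⟩ := hs
  obtain ⟨d', hd', b, hb, ht⟩ := ht
  obtain rfl : d = d' := by exact_mod_cast hd.symm.trans hd'
  obtain rfl : a = b := funext fun e => (ha e).unique (hb e)
  exact tendsto_nhds_unique hs ht

section Semilinear

variable {R R' M M' : Type*} [CommRing R] [CommRing R'] [AddCommGroup M] [AddCommGroup M']
  [Module R M] [Module R' M'] {σ : R →+* R'} {σ' : R' →+* R} [RingHomInvPair σ σ']
  [RingHomInvPair σ' σ]

theorem IsIndecomposableModule.congr (ψ : M ≃ₛₗ[σ] M') (h : IsIndecomposableModule R M) :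
    IsIndecomposableModule R' M' := by
  have := h.1
  refine ⟨ψ.symm.toEquiv.nontrivial, fun A B hAB => ?_⟩
  exact (h.2 _ _ ((Submodule.orderIsoMapComap ψ).symm.isCompl hAB)).imp
    (map_eq_bot_iff _).1 (map_eq_bot_iff _).1

/-- A semilinear equivalence over a ring isomorphism preserves the free rank. -/
theorem IsFreeRank.congr {a : ℕ} (ψ : M ≃ₛₗ[σ] M') (h : IsFreeRank R M a) :
    IsFreeRank R' M' a := by
  let φ : R ≃ₛₗ[σ] R' :=
    { RingEquiv.ofRingHom σ σ' RingHomInvPair.comp_eq₂ RingHomInvPair.comp_eq with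
      map_smul' := fun r x => by simp }
  obtain ⟨⟨n, A, hA, hind, hcard⟩, hmax⟩ := h
  refine ⟨⟨n, fun i => (A i).map ψ.toLinearMap, ?_, fun i => (hind i).congr (ψ.submoduleMap (A i)),
    ?_⟩, ?_⟩
  · have h := (DirectSum.isInternal_submodule_iff_iSupIndep_and_iSup_eq_top _).1 hA
    refine (DirectSum.isInternal_submodule_iff_iSupIndep_and_iSup_eq_top _).2
      ⟨h.1.map_orderIso (Submodule.orderIsoMapComap ψ), ?_⟩
    rw [← Submodule.map_iSup, h.2, Submodule.map_top, LinearEquiv.range]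
  · rw [← hcard]
    refine Nat.card_congr (Equiv.subtypeEquivRight fun i => ⟨fun ⟨f⟩ => ⟨?_⟩, fun ⟨f⟩ => ⟨?_⟩⟩)
    · exact ((ψ.submoduleMap (A i)).trans f).trans φ.symm
    · exact ((ψ.submoduleMap (A i)).symm.trans f).trans φ
  · rintro b ⟨f, hf⟩
    let Φ : (Fin b → R) ≃ₛₗ[σ] (Fin b → R') :=
      { Equiv.piCongrRight fun _ : Fin b => φ.toEquiv with
        map_add' := fun x y => by ext i; exact map_add φ _ _
        map_smul' := fun r x => by ext i; exact map_smulₛₗ φ r (x i) }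
    exact hmax b ⟨(Φ.symm.toLinearMap.comp f).comp ψ.toLinearMap,
      Φ.symm.surjective.comp (hf.comp ψ.surjective)⟩

end Semilinear

/-- A ring isomorphism commutes with Frobenius, so it is semilinear between the pushforwards. -/
theorem HasFSignature.congr {p : ℕ} {R R' : Type*} [CommRing R] [ExpChar R p] [CommRing R']
    [ExpChar R' p] {s : ℝ} (φ : R ≃+* R') (h : HasFSignature p R s) : HasFSignature p R' s := by
  obtain ⟨d, hd, a, ha, hs⟩ := h
  refine ⟨d, (ringKrullDim_eq_of_ringEquiv φ).symm.trans hd, a, fun e => ?_, hs⟩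
  have := RingHomInvPair.of_ringEquiv φ
  have := RingHomInvPair.symm (φ : R →+* R') (φ.symm : R' →+* R)
  let ψ : FrobeniusPushforward p e R ≃ₛₗ[(φ : R →+* R')] FrobeniusPushforward p e R' :=
    { ((of p e R).symm.trans φ.toAddEquiv).trans (of p e R') with
      map_smul' := fun r x => by
        obtain ⟨x, rfl⟩ := (of p e R).surjective x
        simp [smul_of] }
  exact (ha e).congr ψ

end Signature

/-! ### Torus factors -/

section Torus

theorem AddSubmonoid.IsFullSaturated.prod_top {M M' : Type*} [AddCommGroup M]
    [AddCommGroup M'] {S : AddSubmonoid M} (hS : S.IsFullSaturated) : (S.prod (⊤ : AddSubmonoid M')).IsFullSaturated := by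
  refine ⟨fun n m hn hm => ⟨hS.saturated n m.1 hn hm.1, trivial⟩, ?_⟩
  obtain ⟨s, hs, h⟩ := hS.exists_interior
  refine ⟨(s, 0), ⟨hs, trivial⟩, fun m => ?_⟩
  obtain ⟨K, hK⟩ := h m.1
  exact ⟨K, hK, trivial⟩

variable {p : ℕ} {k : Type*} [Field k] [ExpChar k p] [PerfectRing k p]
variable {M : Type*} [AddCommGroup M] [Module.Free ℤ M] [Module.Finite ℤ M] {S : AddSubmonoid M}

/-- Reduction modulo `q` of a lattice, in coordinates. -/
def latticeMod (M : Type*) [AddCommGroup M] [Module.Free ℤ M] [Module.Finite ℤ M] (q : ℕ) :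
    M →+ (Module.Free.ChooseBasisIndex ℤ M → ZMod q) where
  toFun m i := ((Module.Free.chooseBasis ℤ M).equivFun m i : ZMod q)
  map_zero' := by ext; simp
  map_add' x y := by ext; simp

theorem latticeMod_nsmul (q : ℕ) (m : M) : latticeMod M q (q • m) = 0 := by
  ext i; simp [latticeMod]

theorem exists_eq_nsmul_of_latticeMod_eq_zero (q : ℕ) (m : M) (h : latticeMod M q m = 0) :
    ∃ u, m = q • u := by
  have h1 (i) : ∃ c : ℤ, (Module.Free.chooseBasis ℤ M).equivFun m i = q * c :=
    (ZMod.intCast_zmod_eq_zero_iff_dvd _ q).1 (congrFun h i)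
  choose c hc using h1
  refine ⟨(Module.Free.chooseBasis ℤ M).equivFun.symm c, ?_⟩
  apply (Module.Free.chooseBasis ℤ M).equivFun.injective
  ext i
  rw [hc, map_nsmul, LinearEquiv.apply_symm_apply, Pi.smul_apply, nsmul_eq_mul]

theorem latticeMod_surjective (q : ℕ) : Function.Surjective (latticeMod M q) := by
  intro c
  choose d hd using fun i => ZMod.intCast_surjective (c i)
  refine ⟨(Module.Free.chooseBasis ℤ M).equivFun.symm d, ?_⟩
  ext i
  simp only [latticeMod, AddMonoidHom.coe_mk, ZeroHom.coe_mk, LinearEquiv.apply_symm_apply, hd]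

variable (S) in
/-- The number of free classes modulo `q`. -/
def freeClassCount (q : ℕ) : ℕ := Nat.card {c // IsFreeClass S (latticeMod M q) c}

theorem isFreeRank_freeClassCount (hS : S.IsFullSaturated) (e : ℕ) :
    IsFreeRank (AddMonoidAlgebra k S) (FrobeniusPushforward p e (AddMonoidAlgebra k S))
      (freeClassCount S (p ^ e)) := by
  have : NeZero (p ^ e) := ⟨(pow_pos (expChar_pos k p) e).ne'⟩
  exact isFreeRank_pushforward hS (latticeMod_nsmul _) (exists_eq_nsmul_of_latticeMod_eq_zero _)
    (latticeMod_surjective _)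

/-- The factor `ℤ^r` imposes no positivity: a class is free exactly when its first component is, and
the second takes all `(p^e)^r` values. -/
theorem isFreeRank_prod_top (hS : S.IsFullSaturated) (e r : ℕ) :
    IsFreeRank (AddMonoidAlgebra k (S.prod (⊤ : AddSubmonoid (Fin r → ℤ))))
      (FrobeniusPushforward p e (AddMonoidAlgebra k (S.prod (⊤ : AddSubmonoid (Fin r → ℤ)))))
      (freeClassCount S (p ^ e) * (p ^ e) ^ r) := by
  have : NeZero (p ^ e) := ⟨(pow_pos (expChar_pos k p) e).ne'⟩
  let ρ : (Fin r → ℤ) →+ (Fin r → ZMod (p ^ e)) :=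
    (Int.castAddHom (ZMod (p ^ e))).compLeft (Fin r)
  have hρ (x) (i) : ρ x i = (x i : ZMod (p ^ e)) := rfl
  let π := (latticeMod M (p ^ e)).prodMap ρ
  have hρs : Function.Surjective ρ := fun c => by
    choose d hd using fun i => ZMod.intCast_surjective (c i)
    exact ⟨d, funext hd⟩
  have h := isFreeRank_pushforward (k := k) (p := p) (e := e) (π := π)
    (hS.prod_top (M' := Fin r → ℤ)) ?_ ?_ ?_
  · convert h using 1
    have hiff (c) : IsFreeClass (S.prod (⊤ : AddSubmonoid (Fin r → ℤ))) π c ↔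
        IsFreeClass S (latticeMod M (p ^ e)) c.1 := by
      constructor
      · rintro ⟨m₀, hm₀, rfl, hmin⟩
        exact ⟨m₀.1, hm₀.1, rfl, fun m hm hmc => (hmin (m, m₀.2) ⟨hm, trivial⟩
          (Prod.ext hmc rfl)).1⟩
      · rintro ⟨m₀, hm₀, hc, hmin⟩
        obtain ⟨d, hd⟩ := hρs c.2
        exact ⟨(m₀, d), ⟨hm₀, trivial⟩, Prod.ext hc hd, fun m hm hmc =>
          ⟨hmin m.1 hm.1 (congrArg Prod.fst hmc), trivial⟩⟩
    rw [Nat.card_congr (Equiv.subtypeEquivRight hiff), freeClassCount]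
    have : Nat.card (Fin r → ZMod (p ^ e)) = (p ^ e) ^ r := by
      simp [Nat.card_eq_fintype_card, ZMod.card]
    rw [← this, ← Nat.card_prod]
    exact Nat.card_congr (Equiv.prodSubtypeFstEquivSubtypeProd (p := fun c =>
      IsFreeClass S (latticeMod M (p ^ e)) c)).symm
  · intro m
    refine Prod.ext (latticeMod_nsmul _ m.1) ?_
    ext i
    have hq : ((p ^ e : ℕ) : ZMod (p ^ e)) = 0 := ZMod.natCast_self _
    push_cast at hq
    simp [π, hρ, hq]
  · intro m hm
    obtain ⟨u, hu⟩ := exists_eq_nsmul_of_latticeMod_eq_zero (p ^ e) m.1 (congrArg Prod.fst hm)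
    have h2 : ρ m.2 = 0 := congrArg Prod.snd hm
    choose v hv using fun i => (ZMod.intCast_zmod_eq_zero_iff_dvd (m.2 i) (p ^ e)).1 (congrFun h2 i)
    refine ⟨(u, v), Prod.ext hu ?_⟩
    ext i
    simp [hv]
  · exact (latticeMod_surjective _).prodMap hρs

/-- A torus factor does not change the F-signature. -/
theorem HasFSignature.prod_top (hS : S.IsFullSaturated) {s : ℝ}
    (h : HasFSignature p (AddMonoidAlgebra k S) s) (r : ℕ) :
    HasFSignature p (AddMonoidAlgebra k (S.prod (⊤ : AddSubmonoid (Fin r → ℤ)))) s := by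
  obtain ⟨d, hd, a, ha, hs⟩ := h
  -- `HasFSignature` only asserts that some `d` and `a` exist; both are unique, hence equal to the
  -- rank and the count of free classes.
  obtain rfl : d = Module.finrank ℤ M := by
    exact_mod_cast hd.symm.trans (ringKrullDim_semigroupRing hS)
  obtain rfl : a = fun e => freeClassCount S (p ^ e) :=
    funext fun e => (ha e).unique (isFreeRank_freeClassCount hS e)
  refine ⟨Module.finrank ℤ (M × (Fin r → ℤ)), ringKrullDim_semigroupRing hS.prod_top, _,
    fun e => isFreeRank_prod_top hS e r, ?_⟩
  have hp : (p : ℝ) ≠ 0 := Nat.cast_ne_zero.2 (expChar_pos k p).ne'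
  refine hs.congr fun e => ?_
  rw [Module.finrank_prod, Module.finrank_fin_fun, mul_add, pow_add, pow_mul (p : ℝ) e r]
  push_cast
  rw [mul_div_mul_right _ _ (by positivity)]

theorem HasFSignature.prod_torus (hS : S.IsFullSaturated) {s : ℝ}
    (h : HasFSignature p (AddMonoidAlgebra k S) s) (r : ℕ) :
    HasFSignature p (AddMonoidAlgebra k (S × (Fin r → ℤ))) s :=
  (h.prod_top hS r).congr (domCongr k k
    ((AddSubmonoid.prodEquiv S ⊤).trans
      ((AddEquiv.refl S).prodCongr AddSubmonoid.topEquiv))).toRingEquiv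

end Torus

end

noncomputable section

/-! ### Separation in lattices -/

section Separation

/-- If no nontrivial nonnegative combination of the `w j` lies in the subspace `L`, some linear
form vanishes on `L` and is positive on every `w j`. -/
theorem exists_dual_pos_pi {ι J : Type*} [Finite ι] [Fintype J] (L : Submodule ℝ (ι → ℝ))
    (w : J → (ι → ℝ))
    (h : ∀ a : J → ℝ, (∀ j, 0 ≤ a j) → ∑ j, a j • w j ∈ L → ∀ j, a j = 0) :
    ∃ f : Module.Dual ℝ (ι → ℝ), (∀ x ∈ L, f x = 0) ∧ ∀ j, 0 < f (w j) := by
  classical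
  have := Fintype.ofFinite ι
  let A : (J → ℝ) →ₗ[ℝ] (ι → ℝ) := Fintype.linearCombination ℝ w
  have hA (a) : A a = ∑ j, a j • w j := Fintype.linearCombination_apply ..
  -- By hypothesis the convex hull of the `w j`, the image of the simplex, misses `L`; it is
  -- compact, so it is strictly separated from `L`.
  obtain ⟨f, u, v, hu, huv, hv⟩ := geometric_hahn_banach_compact_closed
    ((convex_stdSimplex ℝ J).linear_image A)
    ((isCompact_stdSimplex ℝ J).image A.continuous_of_finiteDimensional)
    L.convex L.closed_of_finiteDimensional (by
      rw [Set.disjoint_left]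
      rintro _ ⟨a, ⟨ha0, ha1⟩, rfl⟩ hL
      rw [hA] at hL
      simp [h a ha0 hL] at ha1)
  have hv0 : v < 0 := by simpa using hv 0 L.zero_mem
  -- A form bounded below on a subspace vanishes there.
  have hL (x) (hx : x ∈ L) : f x = 0 := by
    by_contra hne
    have := hv _ (L.smul_mem (v / f x) hx)
    rw [map_smul, smul_eq_mul, div_mul_cancel₀ _ hne] at this
    exact lt_irrefl _ this
  refine ⟨-f.toLinearMap, fun x hx => by simp [hL x hx], fun j => ?_⟩
  have := hu (w j) ⟨Pi.single j 1, single_mem_stdSimplex ℝ j, by rw [hA]; simp [Pi.single_apply]⟩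
  simpa using this.trans (huv.trans hv0)

theorem exists_dual_pos {E J : Type*} [AddCommGroup E] [Module ℝ E] [FiniteDimensional ℝ E]
    [Fintype J] (L : Submodule ℝ E) (w : J → E)
    (h : ∀ a : J → ℝ, (∀ j, 0 ≤ a j) → ∑ j, a j • w j ∈ L → ∀ j, a j = 0) :
    ∃ f : Module.Dual ℝ E, (∀ x ∈ L, f x = 0) ∧ ∀ j, 0 < f (w j) := by
  let b := (Module.finBasis ℝ E).equivFun
  obtain ⟨f, hf, hfw⟩ := exists_dual_pos_pi (L.map b.toLinearMap) (fun j => b (w j))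
    fun a ha hL => h a ha (by
      obtain ⟨x, hx, hxe⟩ := hL
      have : b (∑ j, a j • w j) = b x := by simpa using hxe.symm
      rwa [b.injective this])
  exact ⟨f ∘ₗ b.toLinearMap, fun x hx => hf _ ⟨x, hx, rfl⟩, hfw⟩

/-- A real form on a lattice that is positive on finitely many vectors can be replaced by an
integral one with at least the same zeros. -/
theorem exists_int_dual_pos {N : Type*} [AddCommGroup N] [Module.Finite ℤ N] (f : N →ₗ[ℤ] ℝ)
    {V : Set N} (hV : V.Finite) (hf : ∀ v ∈ V, 0 < f v) :
    ∃ m : Module.Dual ℤ N, (∀ v ∈ V, 0 < m v) ∧ ∀ z, f z = 0 → m z = 0 := by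
  -- The image of `f` is a lattice, so `f = ∑ β i • c i` with integral `c i`, and `f z = 0` forces
  -- every `c i z = 0`.
  let β := Module.finBasis ℤ (LinearMap.range f)
  let c (i) : Module.Dual ℤ N := β.coord i ∘ₗ f.rangeRestrict
  have hc (n : N) : f n = ∑ i, (c i n : ℝ) * (β i : ℝ) := by
    have := congrArg (LinearMap.range f).subtype (β.sum_repr (f.rangeRestrict n))
    rw [map_sum] at this
    refine Eq.trans this.symm (Finset.sum_congr rfl fun i _ => ?_)
    rw [map_smul, zsmul_eq_mul]
    rfl
  -- Rounding each `K β i` down changes the value at `v` by at most `∑ |c i v|`, which is less than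
  -- `K f v` for large `K`.
  obtain ⟨K, hK⟩ : ∃ K : ℝ, ∀ v ∈ V, ∑ i, |(c i v : ℝ)| < K * f v := by
    have : ∀ᶠ K : ℝ in Filter.atTop, ∀ v ∈ V, ∑ i, |(c i v : ℝ)| < K * f v :=
      (Filter.eventually_all_finite hV).2 fun v hv =>
        (Filter.tendsto_id.atTop_mul_const (hf v hv)).eventually_gt_atTop _
    exact this.exists
  refine ⟨∑ i, ⌊K * (β i : ℝ)⌋ • c i, fun v hv => ?_, fun z hz => ?_⟩
  · have h1 : K * f v - ∑ i, |(c i v : ℝ)| ≤ ∑ i, (⌊K * (β i : ℝ)⌋ : ℝ) * (c i v : ℝ) := by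
      rw [hc, Finset.mul_sum, ← Finset.sum_sub_distrib]
      refine Finset.sum_le_sum fun i _ => ?_
      have h2 := Int.floor_le (K * (β i : ℝ))
      have h3 := Int.lt_floor_add_one (K * (β i : ℝ))
      have h4 : (K * β i - ⌊K * (β i : ℝ)⌋) * c i v ≤ |(c i v : ℝ)| := by
        refine (le_abs_self _).trans ?_
        rw [abs_mul]
        refine mul_le_of_le_one_left (abs_nonneg _) ?_
        rw [abs_le]
        constructor <;> linarith
      nlinarith
    have h5 : (0 : ℝ) < ∑ i, (⌊K * (β i : ℝ)⌋ : ℝ) * (c i v : ℝ) := by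
      linarith [hK v hv]
    simp only [LinearMap.sum_apply, LinearMap.smul_apply, smul_eq_mul]
    exact_mod_cast h5
  · have : f.rangeRestrict z = 0 := Subtype.ext hz
    simp [c, this]

end Separation

/-! ### Primitive generators of a rational cone -/

section Cone

variable {N : Type*} [AddCommGroup N]

/-- The inclusion of a lattice in its real vector space, as a linear map. -/
def latticeVecHom (N : Type*) [AddCommGroup N] : N →ₗ[ℤ] LatticeReal N :=
  TensorProduct.mk ℤ ℝ N 1

theorem latticeVecHom_apply (v : N) : latticeVecHom N v = latticeVec v := rfl

theorem latticeVec_nsmul (c : ℕ) (v : N) : latticeVec (c • v) = (c : ℝ) • latticeVec v := by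
  rw [← latticeVecHom_apply, map_nsmul, latticeVecHom_apply, Nat.cast_smul_eq_nsmul]

theorem latticeVec_zsmul (c : ℤ) (v : N) : latticeVec (c • v) = (c : ℝ) • latticeVec v := by
  rw [← latticeVecHom_apply, map_zsmul, latticeVecHom_apply, Int.cast_smul_eq_zsmul]

theorem baseChange_latticeVec (m : Module.Dual ℤ N) (v : N) :
    Module.Dual.baseChange ℝ m (latticeVec v) = (m v : ℝ) := by
  rw [latticeVec, Module.Dual.baseChange_apply_tmul]; simp

theorem mem_toricMonoid_hull {T : Set N} {m : Module.Dual ℤ N} :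
    m ∈ toricMonoid (PointedCone.hull ℝ (latticeVec '' T)) ↔ ∀ t ∈ T, 0 ≤ m t := by
  rw [toricMonoid, AddSubmonoid.mem_comap, dualCone, PointedCone.dual_hull]
  change (∀ ⦃x⦄, x ∈ latticeVec '' T → 0 ≤ Module.Dual.baseChange ℝ m x) ↔ _
  simp [baseChange_latticeVec]

theorem span_range_latticeVec : Submodule.span ℝ (Set.range (latticeVec (N := N))) = ⊤ := by
  rw [eq_top_iff]
  rintro x -
  induction x using TensorProduct.induction_on with
  | zero => exact Submodule.zero_mem _
  | add x y hx hy => exact Submodule.add_mem _ hx hy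
  | tmul r v =>
    have : r ⊗ₜ[ℤ] v = r • latticeVec v := by
      rw [latticeVec, TensorProduct.smul_tmul']; simp
    rw [this]
    exact Submodule.smul_mem _ _ (Submodule.subset_span ⟨v, rfl⟩)

theorem mem_hull_image_finset {E ι : Type*} [AddCommGroup E] [Module ℝ E] {g : ι → E}
    {T : Finset ι} {x : E} : x ∈ PointedCone.hull ℝ (g '' (T : Set ι)) ↔
      ∃ a : ι → ℝ, (∀ i, 0 ≤ a i) ∧ ∑ i ∈ T, a i • g i = x := by
  classical
  constructor
  · intro hx
    obtain ⟨c, hc⟩ := (Submodule.mem_span_image_finset_iff_exists_fun _).1 hx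
    refine ⟨fun i => if h : i ∈ T then (c ⟨i, h⟩ : ℝ) else 0, fun i => ?_, ?_⟩
    · dsimp only
      split_ifs with h
      · exact (c ⟨i, h⟩).2
      · exact le_rfl
    · rw [← hc, ← Finset.sum_coe_sort]
      refine Finset.sum_congr rfl fun i _ => ?_
      dsimp only
      rw [dif_pos i.2]
      rfl
  · rintro ⟨a, ha, rfl⟩
    exact Submodule.sum_mem _ fun i hi =>
      PointedCone.smul_mem _ (ha i) (Submodule.subset_span ⟨i, hi, rfl⟩)

theorem mem_hull_singleton {E : Type*} [AddCommGroup E] [Module ℝ E] {x y : E} :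
    x ∈ PointedCone.hull ℝ {y} ↔ ∃ a : ℝ, 0 ≤ a ∧ a • y = x := by
  rw [PointedCone.hull, Submodule.mem_span_singleton]
  exact ⟨fun ⟨a, ha⟩ => ⟨a, a.2, ha⟩, fun ⟨a, h0, ha⟩ => ⟨⟨a, h0⟩, ha⟩⟩

/-- A lattice vector that is not a proper multiple. -/
def IsPrimitiveVec (v : N) : Prop := ∀ (c : ℕ) (w : N), v = c • w → c = 1

theorem IsPrimitiveVec.ne_zero {v : N} (hv : IsPrimitiveVec v) : v ≠ 0 := by
  rintro rfl
  exact zero_ne_one (hv 0 0 (by simp))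

theorem mem_of_mem_primitiveGenerators {σ : PointedCone ℝ (LatticeReal N)} {v : N}
    (hv : v ∈ primitiveGenerators σ) :
    latticeVec v ∈ σ := hv.2.le (Submodule.mem_span_singleton_self _)

variable [Module.Free ℤ N]

theorem latticeVec_injective : Function.Injective (latticeVec (N := N)) := by
  intro u v h
  apply (Module.Free.chooseBasis ℤ N).ext_elem
  intro i
  have := congrArg (Module.Dual.baseChange ℝ ((Module.Free.chooseBasis ℤ N).coord i)) h
  rw [baseChange_latticeVec, baseChange_latticeVec] at this
  exact_mod_cast this

theorem latticeVec_eq_zero {v : N} : latticeVec v = 0 ↔ v = 0 := by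
  rw [← latticeVecHom_apply, map_eq_zero_iff _ latticeVec_injective]

variable [Module.Finite ℤ N]

/-- The values of integral forms at `v` are an ideal `(g)`. All coordinates of `v` are divisible by
`g`, so primitivity gives `g = ±1`. -/
theorem IsPrimitiveVec.exists_dual_eq_one {v : N} (hv : IsPrimitiveVec v) :
    ∃ m : Module.Dual ℤ N, m v = 1 := by
  let b := Module.Free.chooseBasis ℤ N
  let I : Ideal ℤ := LinearMap.range (Module.Dual.eval ℤ N v)
  obtain ⟨g, hg⟩ : ∃ g : ℤ, I = Ideal.span {g} := (IsPrincipalIdealRing.principal I).principal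
  have hdvd (i) : ∃ c, b.equivFun v i = g * c := by
    have : b.equivFun v i ∈ I := ⟨b.coord i, by simp [Module.Dual.eval_apply]⟩
    rw [hg] at this
    exact Ideal.mem_span_singleton.1 this
  choose c hc using hdvd
  have hvg : v = g • b.equivFun.symm c := by
    apply b.equivFun.injective
    ext i
    rw [hc, map_smul, LinearEquiv.apply_symm_apply, Pi.smul_apply, smul_eq_mul]
  have hg1 : g.natAbs = 1 := by
    rcases Int.natAbs_eq g with h | h
    · exact hv _ (b.equivFun.symm c) (by rw [← natCast_zsmul, ← h, ← hvg])
    · refine hv _ (-b.equivFun.symm c) ?_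
      rw [← natCast_zsmul, smul_neg, ← neg_smul, ← h, ← hvg]
  have h1 : (1 : ℤ) ∈ I := by
    rw [hg, Ideal.mem_span_singleton]
    exact Int.natAbs_dvd.1 (by rw [hg1]; simp)
  exact h1

theorem exists_primitive_of_ne_zero {t : N} (ht : t ≠ 0) :
    ∃ (c : ℕ) (v : N), c ≠ 0 ∧ t = c • v ∧ IsPrimitiveVec v := by
  classical
  let b := Module.Free.chooseBasis ℤ N
  obtain ⟨i, hi⟩ : ∃ i, b.repr t i ≠ 0 := by
    by_contra! h
    exact ht (b.ext_elem fun i => by simp [h i])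
  let P (c : ℕ) : Prop := ∃ v : N, t = c • v
  have hP1 : P 1 := ⟨t, by simp⟩
  have hbound (c) (hc : P c) : c ≤ (b.repr t i).natAbs := by
    obtain ⟨v, rfl⟩ := hc
    refine Nat.le_of_dvd (Int.natAbs_pos.2 hi) ?_
    rw [← Int.natCast_dvd, map_nsmul]
    simp
  obtain ⟨v, hv⟩ : P (Nat.findGreatest P (b.repr t i).natAbs) :=
    Nat.findGreatest_spec (hbound 1 hP1) hP1
  have hpos : 0 < Nat.findGreatest P (b.repr t i).natAbs :=
    lt_of_lt_of_le one_pos (Nat.le_findGreatest (hbound 1 hP1) hP1)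
  refine ⟨_, v, hpos.ne', hv, fun c w hcw => ?_⟩
  have hPc : P (Nat.findGreatest P (b.repr t i).natAbs * c) := ⟨w, by rw [mul_smul, ← hcw, ← hv]⟩
  have hle := Nat.le_findGreatest (hbound _ hPc) hPc
  have hc1 : c ≤ 1 := by
    by_contra! h
    nlinarith
  have hc0 : c ≠ 0 := by
    rintro rfl
    rw [zero_smul] at hcw
    rw [hcw, smul_zero] at hv
    exact ht hv
  omega

/-- A form with value `1` at `v` shows that the ratio is the integer `m u`; primitivity of `u` makes
it `1`. -/
theorem IsPrimitiveVec.eq_of_smul_eq {u v : N} (hu : IsPrimitiveVec u) (hv : IsPrimitiveVec v)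
    {a : ℝ} (ha : 0 ≤ a) (h : a • latticeVec v = latticeVec u) : v = u := by
  obtain ⟨m, hm⟩ := hv.exists_dual_eq_one
  have h1 := congrArg (Module.Dual.baseChange ℝ m) h
  rw [map_smul, baseChange_latticeVec, baseChange_latticeVec, hm, Int.cast_one, smul_eq_mul,
    mul_one] at h1
  have h0 : 0 ≤ m u := by rw [h1] at ha; exact_mod_cast ha
  obtain ⟨n, hn⟩ := Int.eq_ofNat_of_zero_le h0
  have hun : u = n • v := by
    apply latticeVec_injective
    rw [latticeVec_nsmul, ← h, h1, hn]
    simp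
  rw [hu n v hun, one_smul] at hun
  exact hun.symm

section Generators

variable {σ : PointedCone ℝ (LatticeReal N)}

/-- If `x + y` is on the ray of `g t`, collecting coefficients writes a multiple of `g t` as a
combination of the other generators. A positive multiple would make `g t` redundant; otherwise the
other parts of `x` lie in `C` together with their negative, so they vanish. -/
theorem isFaceOf_hull_singleton_of_notMem {E ι : Type*} [AddCommGroup E] [Module ℝ E]
    [DecidableEq ι] {C : PointedCone ℝ E} {g : ι → E} {T : Finset ι}
    (hC : C = PointedCone.hull ℝ (g '' (T : Set ι))) (hsc : ∀ x ∈ C, -x ∈ C → x = 0) {t : ι}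
    (ht : t ∈ T) (hmin : g t ∉ PointedCone.hull ℝ (g '' (T.erase t : Finset ι))) :
    (PointedCone.hull ℝ {g t}).IsFaceOf C := by
  have hg (i) (hi : i ∈ T) : g i ∈ C := hC ▸ Submodule.subset_span ⟨i, hi, rfl⟩
  refine PointedCone.IsFaceOf.of_mem_of_add_mem_left ?_ fun {x y} hx hy hxy => ?_
  · rw [PointedCone.hull, Submodule.span_le, Set.singleton_subset_iff]
    exact hg t ht
  obtain ⟨l, hl, hlxy⟩ := mem_hull_singleton.1 hxy
  rw [hC] at hx hy
  obtain ⟨a, ha, rfl⟩ := mem_hull_image_finset.1 hx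
  obtain ⟨b, hb, rfl⟩ := mem_hull_image_finset.1 hy
  have hsum (a : ι → ℝ) : ∑ i ∈ T, a i • g i = a t • g t + ∑ i ∈ T.erase t, a i • g i :=
    (Finset.add_sum_erase T (fun i => a i • g i) ht).symm
  have hmem (a : ι → ℝ) (ha : ∀ i, 0 ≤ a i) : ∑ i ∈ T.erase t, a i • g i ∈ C :=
    Submodule.sum_mem _ fun i hi => C.smul_mem (ha i) (hg i (Finset.mem_of_mem_erase hi))
  have key : (l - a t - b t) • g t =
      ∑ i ∈ T.erase t, a i • g i + ∑ i ∈ T.erase t, b i • g i := by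
    rw [hsum a, hsum b] at hlxy
    rw [sub_smul, sub_smul, hlxy]
    abel
  rcases lt_or_ge 0 (l - a t - b t) with hpos | hneg
  · refine absurd ?_ hmin
    have h1 : g t = (l - a t - b t)⁻¹ • ∑ i ∈ T.erase t, (a i + b i) • g i := by
      rw [eq_inv_smul_iff₀ hpos.ne', key, ← Finset.sum_add_distrib]
      simp only [add_smul]
    rw [h1]
    exact PointedCone.smul_mem _ (inv_nonneg.2 hpos.le)
      (mem_hull_image_finset.2 ⟨fun i => a i + b i, fun i => add_nonneg (ha i) (hb i), rfl⟩)
  · have h0 : ∑ i ∈ T.erase t, a i • g i = 0 := by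
      refine hsc _ (hmem a ha) ?_
      have : -∑ i ∈ T.erase t, a i • g i =
          (-(l - a t - b t)) • g t + ∑ i ∈ T.erase t, b i • g i := by
        rw [neg_smul, key]; abel
      rw [this]
      exact C.add_mem (C.smul_mem (neg_nonneg.2 hneg) (hg t ht)) (hmem b hb)
    rw [hsum a, h0, add_zero]
    exact mem_hull_singleton.2 ⟨a t, ha t, rfl⟩

/-- A strongly convex rational cone has finitely many primitive generators, and they generate. -/
theorem IsToricCone.primitiveGenerators_finite_and_hull (hσ : IsToricCone σ) :
    (primitiveGenerators σ).Finite ∧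
      σ = PointedCone.hull ℝ (latticeVec '' primitiveGenerators σ) := by
  classical
  -- A minimal generating set has no redundant member, so each member spans an edge.
  obtain ⟨T, hT, hmin⟩ : ∃ T : Finset N, σ = PointedCone.hull ℝ (latticeVec '' (T : Set N)) ∧
      ∀ t ∈ T, latticeVec t ∉ PointedCone.hull ℝ (latticeVec '' (T.erase t : Set N)) := by
    obtain ⟨T₀, hT₀⟩ := hσ.rational_polyhedral
    obtain ⟨T, hT, hTmin⟩ := exists_minimal_of_wellFoundedLT
      (fun T : Finset N => σ = PointedCone.hull ℝ (latticeVec '' (T : Set N))) ⟨T₀, hT₀⟩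
    refine ⟨T, hT, fun t ht hmem => ?_⟩
    refine Finset.notMem_erase t T (hTmin (y := T.erase t) ?_ (Finset.erase_subset t T) ht)
    refine le_antisymm ?_ ?_
    · rw [hT]
      refine Submodule.span_le.2 ?_
      rintro _ ⟨s, hs, rfl⟩
      by_cases hst : s = t
      · rw [hst]; exact_mod_cast hmem
      · exact Submodule.subset_span ⟨s, by simpa using ⟨hs, hst⟩, rfl⟩
    · rw [hT]
      exact Submodule.span_mono (Set.image_mono (by simp))
  have hface (t) (ht : t ∈ T) : (PointedCone.hull ℝ {latticeVec t}).IsFaceOf σ :=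
    isFaceOf_hull_singleton_of_notMem hT hσ.strongly_convex ht (by exact_mod_cast hmin t ht)
  have hprim (t) (ht : t ∈ T) : ∃ v ∈ primitiveGenerators σ, ∃ c : ℕ, c ≠ 0 ∧ t = c • v := by
    have ht0 : t ≠ 0 := by
      rintro rfl
      refine hmin 0 ht ?_
      rw [latticeVec_eq_zero.2 rfl]
      exact Submodule.zero_mem _
    obtain ⟨c, v, hc, rfl, hv⟩ := exists_primitive_of_ne_zero ht0
    refine ⟨v, ⟨hv, ?_⟩, c, hc, rfl⟩
    have : PointedCone.hull ℝ {latticeVec v} = PointedCone.hull ℝ {latticeVec (c • v)} := by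
      have hc' : (0 : ℝ) < c := by positivity
      ext x
      rw [mem_hull_singleton, mem_hull_singleton, latticeVec_nsmul]
      constructor
      · rintro ⟨a, ha, rfl⟩
        exact ⟨a / c, by positivity, by rw [smul_smul, div_mul_cancel₀ _ hc'.ne']⟩
      · rintro ⟨a, ha, rfl⟩
        exact ⟨a * c, by positivity, by rw [smul_smul]⟩
    rw [this]
    exact hface _ ht
  choose! φ hφ c hc hφc using hprim
  constructor
  · refine (T.finite_toSet.image φ).subset fun v hv => ?_
    have hvσ := mem_of_mem_primitiveGenerators hv
    rw [hT] at hvσ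
    obtain ⟨a, ha, hsum⟩ := mem_hull_image_finset.1 hvσ
    obtain ⟨t, ht, hat⟩ : ∃ t ∈ T, 0 < a t := by
      by_contra! h
      refine IsPrimitiveVec.ne_zero hv.1 (latticeVec_eq_zero.1 ?_)
      rw [← hsum]
      refine Finset.sum_eq_zero fun t ht => ?_
      rw [le_antisymm (h t ht) (ha t), zero_smul]
    refine ⟨t, ht, ?_⟩
    -- `v` is a nonnegative combination of `T` with positive coefficient at `t`; the face property
    -- puts `t` on the ray of `v`.
    have hmem : latticeVec t ∈ PointedCone.hull ℝ {latticeVec v} := by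
      refine hv.2.mem_of_sum_smul_mem (f := fun s : T => latticeVec s.1) (c := fun s => a s.1)
        (fun s => (hface s.1 s.2).le (Submodule.mem_span_singleton_self _)) (fun s => ha _) ?_
        ⟨t, ht⟩ hat
      rw [Finset.sum_coe_sort T (fun s => a s • latticeVec s), hsum]
      exact Submodule.mem_span_singleton_self _
    obtain ⟨l, hl, hlt⟩ := mem_hull_singleton.1 hmem
    have hc' : (0 : ℝ) < c t := by have := hc t ht; positivity
    refine (IsPrimitiveVec.eq_of_smul_eq (hφ t ht).1 hv.1 (a := l / c t) (by positivity) ?_).symm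
    rw [div_eq_inv_mul, mul_smul, hlt]
    rw [congrArg latticeVec (hφc t ht), latticeVec_nsmul, inv_smul_smul₀ hc'.ne']
  · refine le_antisymm ?_ ?_
    · conv_lhs => rw [hT]
      refine Submodule.span_le.2 ?_
      rintro _ ⟨t, ht, rfl⟩
      rw [hφc t ht, latticeVec_nsmul]
      exact PointedCone.smul_mem _ (Nat.cast_nonneg _)
        (Submodule.subset_span ⟨φ t, hφ t ht, rfl⟩)
    · refine Submodule.span_le.2 ?_
      rintro _ ⟨v, hv, rfl⟩
      exact mem_of_mem_primitiveGenerators hv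

theorem IsToricCone.mem_toricMonoid (hσ : IsToricCone σ) {m : Module.Dual ℤ N} :
    m ∈ toricMonoid σ ↔ ∀ v ∈ primitiveGenerators σ, 0 ≤ m v := by
  conv_lhs => rw [hσ.primitiveGenerators_finite_and_hull.2]
  exact mem_toricMonoid_hull

/-- Nonnegative combinations of vectors of a strongly convex cone vanish only trivially. -/
theorem coeff_eq_zero_of_sum_eq_zero {E J : Type*} [AddCommGroup E] [Module ℝ E] [Fintype J]
    {C : PointedCone ℝ E} (hsc : ∀ x ∈ C, -x ∈ C → x = 0) {w : J → E} (hw : ∀ j, w j ∈ C)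
    (hw0 : ∀ j, w j ≠ 0) {a : J → ℝ} (ha : ∀ j, 0 ≤ a j) (h : ∑ j, a j • w j = 0) (j : J) :
    a j = 0 := by
  classical
  have h1 : a j • w j = 0 := by
    refine hsc _ (C.smul_mem (ha j) (hw j)) ?_
    have h2 := Finset.add_sum_erase Finset.univ (fun i => a i • w i) (Finset.mem_univ j)
    rw [h] at h2
    rw [neg_eq_of_add_eq_zero_right h2]
    exact C.sum_mem fun i _ => C.smul_mem (ha i) (hw i)
  exact (smul_eq_zero.1 h1).resolve_right (hw0 j)

theorem IsToricCone.exists_dual_pos (hσ : IsToricCone σ) :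
    ∃ m : Module.Dual ℤ N, ∀ v ∈ primitiveGenerators σ, 0 < m v := by
  have hfin := hσ.primitiveGenerators_finite_and_hull.1
  have := hfin.fintype
  obtain ⟨f, -, hf⟩ := _root_.exists_dual_pos (⊥ : Submodule ℝ (LatticeReal N))
    (fun v : primitiveGenerators σ => latticeVec v.1) fun a ha h =>
      coeff_eq_zero_of_sum_eq_zero hσ.strongly_convex
        (fun v => mem_of_mem_primitiveGenerators v.2)
        (fun v => latticeVec_eq_zero.not.2 (IsPrimitiveVec.ne_zero v.2.1)) ha
        ((Submodule.mem_bot ℝ).1 h)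
  obtain ⟨m, hm, -⟩ := exists_int_dual_pos
    ((f.restrictScalars ℤ) ∘ₗ latticeVecHom N) hfin fun v hv => hf ⟨v, hv⟩
  exact ⟨m, hm⟩

/-- The facet of `σ^∨` dual to an edge of `σ` contains a lattice point in its interior. -/
theorem IsToricCone.exists_dual_facet (hσ : IsToricCone σ) {v : N}
    (hv : v ∈ primitiveGenerators σ) :
    ∃ m : Module.Dual ℤ N, m v = 0 ∧ ∀ w ∈ primitiveGenerators σ, w ≠ v → 0 < m w := by
  have hfin := hσ.primitiveGenerators_finite_and_hull.1
  have hfin' : (primitiveGenerators σ \ {v}).Finite := hfin.sdiff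
  have := hfin'.fintype
  have hv0 : latticeVec v ≠ 0 := latticeVec_eq_zero.not.2 (IsPrimitiveVec.ne_zero hv.1)
  obtain ⟨f, hfv, hf⟩ := _root_.exists_dual_pos (Submodule.span ℝ {latticeVec v})
    (fun w : (primitiveGenerators σ \ {v} : Set N) => latticeVec w.1) fun a ha h => by
      have hmem (w : (primitiveGenerators σ \ {v} : Set N)) : latticeVec w.1 ∈ σ :=
        mem_of_mem_primitiveGenerators w.2.1
      obtain ⟨c, hc⟩ := Submodule.mem_span_singleton.1 h
      -- For `c ≥ 0` the face property would put some `w ≠ v` on the ray of `v`; for `c < 0` the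
      -- cone would contain `-v`.
      rcases le_or_gt 0 c with hc0 | hc0
      · intro w
        by_contra hne
        have h1 := hv.2.mem_of_sum_smul_mem hmem ha (hc ▸ mem_hull_singleton.2 ⟨c, hc0, rfl⟩) w
          (lt_of_le_of_ne (ha w) (Ne.symm hne))
        obtain ⟨l, hl, hlw⟩ := mem_hull_singleton.1 h1
        exact w.2.2 (IsPrimitiveVec.eq_of_smul_eq w.2.1.1 hv.1 hl hlw).symm
      · refine absurd (hσ.strongly_convex _ (mem_of_mem_primitiveGenerators hv) ?_) hv0
        have : -latticeVec v = (-c)⁻¹ • (c • latticeVec v) := by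
          rw [smul_smul, inv_neg, neg_mul, inv_mul_cancel₀ hc0.ne, neg_one_smul]
        rw [this, hc]
        exact σ.smul_mem (inv_nonneg.2 (neg_nonneg.2 hc0.le))
          (σ.sum_mem fun w _ => σ.smul_mem (ha w) (hmem w))
  obtain ⟨m, hm, hmz⟩ := exists_int_dual_pos
    ((f.restrictScalars ℤ) ∘ₗ latticeVecHom N) hfin' fun w hw => hf ⟨w, hw⟩
  exact ⟨m, hmz v (hfv _ (Submodule.mem_span_singleton_self _)), fun w hw hwv => hm w ⟨hw, hwv⟩⟩

theorem IsToricCone.isFullSaturated (hσ : IsToricCone σ) : (toricMonoid σ).IsFullSaturated := by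
  have hfin := hσ.primitiveGenerators_finite_and_hull.1
  constructor
  · intro n m hn hm
    rw [hσ.mem_toricMonoid] at hm ⊢
    intro v hv
    have := hm v hv
    rw [LinearMap.smul_apply, nsmul_eq_mul] at this
    exact nonneg_of_mul_nonneg_right this (by positivity)
  · obtain ⟨s, hs⟩ := hσ.exists_dual_pos
    refine ⟨s, hσ.mem_toricMonoid.2 fun v hv => (hs v hv).le, fun m => ?_⟩
    have : ∀ᶠ K : ℕ in Filter.atTop, ∀ v ∈ primitiveGenerators σ, 0 ≤ m v + K * s v := by
      refine (Filter.eventually_all_finite hfin).2 fun v hv => ?_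
      filter_upwards [Filter.eventually_ge_atTop (m v).natAbs] with K hK
      have h1 : |m v| ≤ K := by rw [Int.abs_eq_natAbs]; exact_mod_cast hK
      nlinarith [hs v hv, neg_abs_le (m v)]
    obtain ⟨K, hK⟩ := this.exists
    exact ⟨K, hσ.mem_toricMonoid.2 fun v hv => by simpa using hK v hv⟩

end Generators

end Cone

end

noncomputable section

open scoped Pointwise

/-! ### Free classes and lattice points of the polytope -/

section Polytope

variable {N : Type*} [AddCommGroup N] [Module.Free ℤ N] {σ : PointedCone ℝ (LatticeReal N)}

variable (N) in
/-- The coordinates on `M_ℝ` given by the chosen basis of `N`. -/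
def dualCoordinates : Module.Dual ℝ (LatticeReal N) ≃ₗ[ℝ]
    (Module.Free.ChooseBasisIndex ℤ N → ℝ) :=
  (((Module.Free.chooseBasis ℤ N).baseChange ℝ).constr ℝ).symm

theorem dualCoordinates_apply (w : Module.Dual ℝ (LatticeReal N)) (i) :
    dualCoordinates N w i = w (latticeVec (Module.Free.chooseBasis ℤ N i)) := by
  simp [dualCoordinates, Module.Basis.constr, latticeVec]

theorem image_toricPolytope : dualCoordinates N '' toricPolytope σ =
    {x | ∀ v ∈ primitiveGenerators σ, 0 ≤ (dualCoordinates N).symm x (latticeVec v) ∧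
      (dualCoordinates N).symm x (latticeVec v) < 1} :=
  (dualCoordinates N).toEquiv.image_eq_preimage_symm _

/-- Convexity ensures that the frontier is null, as the lattice point count requires. -/
theorem convex_image_toricPolytope : Convex ℝ (dualCoordinates N '' toricPolytope σ) := by
  refine Convex.is_linear_image ?_ (dualCoordinates N).toLinearMap.isLinear
  have : toricPolytope σ = ⋂ v ∈ primitiveGenerators σ,
      {w : Module.Dual ℝ (LatticeReal N) | w (latticeVec v) ∈ Set.Ico (0 : ℝ) 1} := by
    ext w; simp [toricPolytope]
  rw [this]
  exact convex_iInter₂ fun v _ =>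
    (convex_Ico (0 : ℝ) 1).is_linear_preimage (Module.Dual.eval ℝ _ (latticeVec v)).isLinear

variable [Module.Finite ℤ N]

/-- Suppose `m` is minimal but `m v ≥ q`. Take `u v = 1`, and `f` vanishing at `v` and positive on
the other generators. For large `K`, `m + q (K f - u)` is in `S` and in the class of `m`, yet is
smaller by `q` at `v`. Conversely, if `0 ≤ m v < q`, another member of `S` in the class differs by
`q u` with `q u(v) > -q`, so the integer `u(v)` is nonnegative. -/
theorem IsToricCone.isFreeClass_iff (hσ : IsToricCone σ) {q : ℕ} (hq : q ≠ 0) {c} :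
    IsFreeClass (toricMonoid σ) (latticeMod (Module.Dual ℤ N) q) c ↔
      ∃ m, latticeMod (Module.Dual ℤ N) q m = c ∧
        ∀ v ∈ primitiveGenerators σ, 0 ≤ m v ∧ m v < q := by
  have hq0 : (0 : ℤ) < q := by positivity
  constructor
  · rintro ⟨m, hm, rfl, hmin⟩
    rw [hσ.mem_toricMonoid] at hm
    refine ⟨m, rfl, fun v hv => ⟨hm v hv, ?_⟩⟩
    by_contra! hge
    obtain ⟨u, hu⟩ := IsPrimitiveVec.exists_dual_eq_one hv.1
    obtain ⟨f, hfv, hf⟩ := hσ.exists_dual_facet hv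
    have : ∀ᶠ K : ℕ in Filter.atTop, ∀ w ∈ primitiveGenerators σ, w ≠ v → u w ≤ K * f w := by
      refine (Filter.eventually_all_finite hσ.primitiveGenerators_finite_and_hull.1).2
        fun w hw => ?_
      filter_upwards [Filter.eventually_ge_atTop (u w).natAbs] with K hK hwv
      have h1 : |u w| ≤ K := by rw [Int.abs_eq_natAbs]; exact_mod_cast hK
      nlinarith [hf w hw hwv, le_abs_self (u w)]
    obtain ⟨K, hK⟩ := this.exists
    have hmem : m + q • (K • f - u) ∈ toricMonoid σ := by
      rw [hσ.mem_toricMonoid]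
      intro w hw
      simp only [LinearMap.add_apply, LinearMap.smul_apply, LinearMap.sub_apply, nsmul_eq_mul]
      by_cases hwv : w = v
      · subst hwv; rw [hfv, hu]; linarith
      · nlinarith [hm w hw, hK w hw hwv]
    have h2 := hmin _ hmem (by rw [map_add, latticeMod_nsmul, add_zero])
    rw [hσ.mem_toricMonoid] at h2
    have h3 := h2 v hv
    simp [hfv, hu] at h3
    omega
  · rintro ⟨m, rfl, hm⟩
    refine ⟨m, hσ.mem_toricMonoid.2 fun v hv => (hm v hv).1, rfl, fun m' hm' h => ?_⟩
    rw [hσ.mem_toricMonoid] at hm' ⊢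
    intro v hv
    obtain ⟨u, hu⟩ := exists_eq_nsmul_of_latticeMod_eq_zero q (m' - m) (by
      rw [map_sub, h, sub_self])
    have h1 : m' v - m v = q * u v := by simpa using LinearMap.congr_fun hu v
    rw [LinearMap.sub_apply, h1]
    have h2 : -(q : ℤ) < q * u v := by linarith [hm' v hv, (hm v hv).2]
    have h3 : -1 < u v := by nlinarith
    exact mul_nonneg hq0.le (by omega)

theorem IsToricCone.span_primitiveGenerators (hσ : IsToricCone σ) (hfull : IsFullDimensional σ) :
    Submodule.span ℝ (latticeVec '' primitiveGenerators σ) = ⊤ := by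
  rw [eq_top_iff, ← hfull, Submodule.span_le]
  intro x hx
  rw [hσ.primitiveGenerators_finite_and_hull.2] at hx
  exact PointedCone.hull_le_span _ _ hx

theorem IsToricCone.dual_eq_zero (hσ : IsToricCone σ) (hfull : IsFullDimensional σ)
    {f : Module.Dual ℝ (LatticeReal N)} (hf : ∀ v ∈ primitiveGenerators σ, f (latticeVec v) = 0) :
    f = 0 := by
  refine LinearMap.ext_on (hσ.span_primitiveGenerators hfull) ?_
  rintro _ ⟨v, hv, rfl⟩
  exact hf v hv

/-- Two such points in one class differ by `q u` with `|u v| < 1` on every generator; the generators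
span, so `u = 0`. -/
theorem IsToricCone.freeClassCount_eq (hσ : IsToricCone σ) (hfull : IsFullDimensional σ) {q : ℕ}
    (hq : q ≠ 0) : freeClassCount (toricMonoid σ) q =
      Nat.card {m : Module.Dual ℤ N // ∀ v ∈ primitiveGenerators σ, 0 ≤ m v ∧ m v < q} := by
  refine (Nat.card_congr (Equiv.ofBijective
    (fun m => ⟨_, (hσ.isFreeClass_iff hq).2 ⟨m.1, rfl, m.2⟩⟩) ⟨?_, ?_⟩)).symm
  · rintro ⟨m, hm⟩ ⟨m', hm'⟩ h
    have h : latticeMod (Module.Dual ℤ N) q m = latticeMod (Module.Dual ℤ N) q m' :=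
      congrArg Subtype.val h
    obtain ⟨u, hu⟩ := exists_eq_nsmul_of_latticeMod_eq_zero q (m - m') (by
      rw [map_sub, h, sub_self])
    have hu0 : ∀ v ∈ primitiveGenerators σ, u v = 0 := fun v hv => by
      have h1 : m v - m' v = q * u v := by simpa using LinearMap.congr_fun hu v
      have h2 := hm v hv
      have h3 := hm' v hv
      have hq0 : (0 : ℤ) < q := by positivity
      have : u v < 1 := by nlinarith
      have : -1 < u v := by nlinarith
      omega
    have : Module.Dual.baseChange ℝ u = 0 := hσ.dual_eq_zero hfull fun v hv => by
      rw [baseChange_latticeVec, hu0 v hv, Int.cast_zero]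
    have hu' : u = 0 := by
      ext v
      have h0 := baseChange_latticeVec u v
      rw [this, LinearMap.zero_apply] at h0
      exact_mod_cast h0.symm
    apply Subtype.ext
    rwa [hu', smul_zero, sub_eq_zero] at hu
  · rintro ⟨c, hc⟩
    obtain ⟨m, rfl, hm⟩ := (hσ.isFreeClass_iff hq).1 hc
    exact ⟨⟨m, hm⟩, rfl⟩

theorem latticeVolume_eq (P : Set (Module.Dual ℝ (LatticeReal N))) :
    latticeVolume P = MeasureTheory.volume (dualCoordinates N '' P) := by
  rw [latticeVolume]
  congr 2
  ext w i
  exact (dualCoordinates_apply w i).symm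

theorem IsToricCone.measurableSet_image_toricPolytope (hσ : IsToricCone σ) :
    MeasurableSet (dualCoordinates N '' toricPolytope σ) := by
  have : dualCoordinates N '' toricPolytope σ = ⋂ v ∈ primitiveGenerators σ,
      {x | (dualCoordinates N).symm x (latticeVec v) ∈ Set.Ico (0 : ℝ) 1} := by
    rw [image_toricPolytope]; ext w; simp
  rw [this]
  refine MeasurableSet.biInter hσ.primitiveGenerators_finite_and_hull.1.countable fun v _ => ?_
  let g : (Module.Free.ChooseBasisIndex ℤ N → ℝ) →ₗ[ℝ] ℝ :=
    Module.Dual.eval ℝ _ (latticeVec v) ∘ₗ (dualCoordinates N).symm.toLinearMap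
  exact g.continuous_of_finiteDimensional.measurable measurableSet_Ico

/-- Evaluation on the generators is injective linear, hence antilipschitz, and sends the polytope
into a unit box. -/
theorem IsToricCone.isBounded_image_toricPolytope (hσ : IsToricCone σ)
    (hfull : IsFullDimensional σ) :
    Bornology.IsBounded (dualCoordinates N '' toricPolytope σ) := by
  have := hσ.primitiveGenerators_finite_and_hull.1.fintype
  let g : (Module.Free.ChooseBasisIndex ℤ N → ℝ) →ₗ[ℝ] (primitiveGenerators σ → ℝ) :=
    LinearMap.pi fun v =>
      Module.Dual.eval ℝ _ (latticeVec v.1) ∘ₗ (dualCoordinates N).symm.toLinearMap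
  have hg : LinearMap.ker g = ⊥ := by
    rw [LinearMap.ker_eq_bot']
    intro x hx
    have : (dualCoordinates N).symm x = 0 :=
      hσ.dual_eq_zero hfull fun v hv => congrFun hx ⟨v, hv⟩
    simpa using this
  obtain ⟨K, -, hK⟩ := g.exists_antilipschitzWith hg
  refine (hK.isBounded_preimage (Metric.isBounded_Icc (0 : primitiveGenerators σ → ℝ) 1)).subset ?_
  rw [image_toricPolytope]
  exact fun x hx => ⟨fun v => (hx v.1 v.2).1, fun v => (hx v.1 v.2).2.le⟩

theorem IsToricCone.latticeVolume_ne_top (hσ : IsToricCone σ) (hfull : IsFullDimensional σ) :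
    latticeVolume (toricPolytope σ) ≠ ⊤ := by
  rw [latticeVolume_eq]
  exact (hσ.isBounded_image_toricPolytope hfull).measure_lt_top.ne

/-- The bijection is `m ↦ q⁻¹ m`; in the chosen coordinates `M` is the standard lattice. -/
theorem card_latticePoints {q : ℕ} (hq : q ≠ 0) :
    Nat.card {m : Module.Dual ℤ N // ∀ v ∈ primitiveGenerators σ, 0 ≤ m v ∧ m v < q} =
      Nat.card ↑(dualCoordinates N '' toricPolytope σ ∩ (q : ℝ)⁻¹ •
        (Submodule.span ℤ (Set.range (Pi.basisFun ℝ (Module.Free.ChooseBasisIndex ℤ N))) :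
          Set (Module.Free.ChooseBasisIndex ℤ N → ℝ))) := by
  have hq0 : (0 : ℝ) < q := by positivity
  have hcoord (m : Module.Dual ℤ N) (i) :
      dualCoordinates N (Module.Dual.baseChange ℝ m) i =
        (m (Module.Free.chooseBasis ℤ N i) : ℝ) := by
    rw [dualCoordinates_apply, baseChange_latticeVec]
  have hiff (m : Module.Dual ℤ N) : (q : ℝ)⁻¹ • Module.Dual.baseChange ℝ m ∈ toricPolytope σ ↔
      ∀ v ∈ primitiveGenerators σ, 0 ≤ m v ∧ m v < q := by
    refine forall₂_congr fun v _ => ?_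
    rw [LinearMap.smul_apply, baseChange_latticeVec, smul_eq_mul, inv_mul_lt_iff₀ hq0, mul_one,
      mul_nonneg_iff_of_pos_left (inv_pos.2 hq0)]
    norm_cast
  refine Nat.card_congr (Equiv.ofBijective (fun m => ⟨dualCoordinates N
    ((q : ℝ)⁻¹ • Module.Dual.baseChange ℝ m.1), ⟨_, (hiff m.1).2 m.2, rfl⟩, ?_⟩) ⟨?_, ?_⟩)
  · rw [map_smul]
    refine Set.smul_mem_smul_set ?_
    rw [SetLike.mem_coe, Module.Basis.mem_span_iff_repr_mem]
    intro i
    exact ⟨m.1 (Module.Free.chooseBasis ℤ N i), by simp [hcoord]⟩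
  · rintro ⟨m, hm⟩ ⟨m', hm'⟩ h
    have h1 : dualCoordinates N ((q : ℝ)⁻¹ • Module.Dual.baseChange ℝ m) =
      dualCoordinates N ((q : ℝ)⁻¹ • Module.Dual.baseChange ℝ m') := congrArg Subtype.val h
    rw [map_smul, map_smul] at h1
    have h2 := smul_right_injective _ (inv_pos.2 hq0).ne' h1
    apply Subtype.ext
    refine (Module.Free.chooseBasis ℤ N).ext fun i => ?_
    have h3 := congrFun h2 i
    rw [hcoord, hcoord] at h3
    exact_mod_cast h3
  · rintro ⟨x, hx, hxL⟩
    obtain ⟨y, hy, rfl⟩ := hxL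
    rw [SetLike.mem_coe, Module.Basis.mem_span_iff_repr_mem] at hy
    choose c hc using hy
    let m : Module.Dual ℤ N := (Module.Free.chooseBasis ℤ N).constr ℤ c
    have hmy : dualCoordinates N (Module.Dual.baseChange ℝ m) = y := by
      ext i
      rw [hcoord, Module.Basis.constr_basis]
      simpa using hc i
    have hmx : dualCoordinates N ((q : ℝ)⁻¹ • Module.Dual.baseChange ℝ m) = (q : ℝ)⁻¹ • y := by
      rw [map_smul, hmy]
    refine ⟨⟨m, (hiff m).1 ?_⟩, Subtype.ext hmx⟩
    obtain ⟨w, hw, hwy⟩ := hx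
    rwa [(dualCoordinates N).injective (hmx.trans hwy.symm)]

/-- The F-signature of an affine toric variety without torus factors. -/
theorem IsToricCone.hasFSignature {p : ℕ} {k : Type*} [Field k] [ExpChar k p] [PerfectRing k p]
    (hp : 1 < p) (hσ : IsToricCone σ) (hfull : IsFullDimensional σ) :
    HasFSignature p (ToricRing k σ) (latticeVolume (toricPolytope σ)).toReal := by
  refine ⟨_, ringKrullDim_semigroupRing hσ.isFullSaturated, _,
    isFreeRank_freeClassCount hσ.isFullSaturated, ?_⟩
  -- The Riemann sum limit over all `q` is restricted to `q = p^e`, which tends to infinity because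
  -- `p > 1`.
  have h := (tendsto_card_div_pow_atTop_volume (dualCoordinates N '' toricPolytope σ)
    (hσ.isBounded_image_toricPolytope hfull) hσ.measurableSet_image_toricPolytope
    (convex_image_toricPolytope.addHaar_frontier _)).comp (tendsto_pow_atTop_atTop_of_one_lt hp)
  rw [latticeVolume_eq]
  refine h.congr fun e => ?_
  have hq : p ^ e ≠ 0 := pow_ne_zero _ (by omega)
  rw [Function.comp_apply, hσ.freeClassCount_eq hfull hq, card_latticePoints hq]
  classical
  rw [Nat.cast_pow, ← pow_mul, ← (Module.Free.chooseBasis ℤ N).toDualEquiv.finrank_eq,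
    Module.finrank_eq_card_chooseBasisIndex]

end Polytope

end

noncomputable section

/-! ### Splitting off the torus factor -/

section SpanCone

variable {N : Type*} [AddCommGroup N] {σ : PointedCone ℝ (LatticeReal N)}

theorem mem_spanLattice {v : N} :
    v ∈ spanLattice σ ↔ latticeVec v ∈ Submodule.span ℝ (σ : Set (LatticeReal N)) := Iff.rfl

theorem baseChange_subtype_latticeVec (v : spanLattice σ) :
    (spanLattice σ).subtype.baseChange ℝ (latticeVec v) = latticeVec (v : N) := by
  rw [latticeVec, LinearMap.baseChange_tmul]; rfl

variable [Module.Finite ℤ N]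

/-- The lattice `N ∩ span σ` is a direct summand of `N`. -/
theorem exists_retraction_spanLattice (σ : PointedCone ℝ (LatticeReal N)) :
    ∃ ρ : N →ₗ[ℤ] spanLattice σ, ρ ∘ₗ (spanLattice σ).subtype = LinearMap.id := by
  -- `N'` is cut out by a real subspace, so the quotient is torsion-free, hence free, and the
  -- projection splits.
  have : Module.IsTorsionFree ℤ (N ⧸ spanLattice σ) := by
    refine Module.IsTorsionFree.of_smul_eq_zero fun c x hx => ?_
    obtain ⟨v, rfl⟩ := Submodule.mkQ_surjective _ x
    rw [← map_smul, Submodule.mkQ_apply, Submodule.Quotient.mk_eq_zero, mem_spanLattice,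
      latticeVec_zsmul] at hx
    rw [or_iff_not_imp_left]
    intro hc
    rw [Submodule.mkQ_apply, Submodule.Quotient.mk_eq_zero, mem_spanLattice]
    exact (Submodule.smul_mem_iff _ (Int.cast_ne_zero.2 hc)).1 hx
  have : Module.Free ℤ (N ⧸ spanLattice σ) := inferInstance
  obtain ⟨g, hg⟩ := LinearMap.exists_rightInverse_of_surjective (spanLattice σ).mkQ
    (Submodule.range_mkQ _)
  have hmem (v : N) : (LinearMap.id - g ∘ₗ (spanLattice σ).mkQ : N →ₗ[ℤ] N) v ∈ spanLattice σ := by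
    have := LinearMap.congr_fun hg ((spanLattice σ).mkQ v)
    rw [LinearMap.comp_apply, LinearMap.id_apply] at this
    rw [← Submodule.Quotient.mk_eq_zero, ← Submodule.mkQ_apply, LinearMap.sub_apply, map_sub,
      LinearMap.comp_apply, LinearMap.id_apply, this, sub_self]
  refine ⟨(LinearMap.id - g ∘ₗ (spanLattice σ).mkQ : N →ₗ[ℤ] N).codRestrict _ hmem, ?_⟩
  ext v
  have : (spanLattice σ).mkQ (v : N) = 0 := (Submodule.Quotient.mk_eq_zero _).2 v.2
  simp [this]

theorem baseChange_subtype_injective (σ : PointedCone ℝ (LatticeReal N)) :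
    Function.Injective ((spanLattice σ).subtype.baseChange ℝ) := by
  obtain ⟨ρ, hρ⟩ := exists_retraction_spanLattice σ
  refine Function.LeftInverse.injective (g := ρ.baseChange ℝ) fun x => ?_
  rw [← LinearMap.comp_apply, ← LinearMap.baseChange_comp, hρ, LinearMap.baseChange_id,
    LinearMap.id_apply]

theorem spanCone_eq_hull {T : Set N} (hT : σ = PointedCone.hull ℝ (latticeVec '' T)) :
    spanCone σ = PointedCone.hull ℝ (latticeVec '' ((spanLattice σ).subtype ⁻¹' T)) := by
  have hTmem (t) (ht : t ∈ T) : latticeVec t ∈ σ := by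
    rw [hT]; exact Submodule.subset_span ⟨t, ht, rfl⟩
  apply le_antisymm
  · intro x hx
    have hx : (spanLattice σ).subtype.baseChange ℝ x ∈ σ := hx
    have : σ ≤ (PointedCone.hull ℝ (latticeVec '' ((spanLattice σ).subtype ⁻¹' T))).map
        ((spanLattice σ).subtype.baseChange ℝ) := by
      conv_lhs => rw [hT]
      refine Submodule.span_le.2 ?_
      rintro _ ⟨t, ht, rfl⟩
      have htm : t ∈ spanLattice σ := mem_spanLattice.2 (Submodule.subset_span (hTmem t ht))
      exact ⟨latticeVec ⟨t, htm⟩, Submodule.subset_span ⟨⟨t, htm⟩, ht, rfl⟩,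
        baseChange_subtype_latticeVec _⟩
    obtain ⟨y, hy, hyx⟩ := this hx
    rwa [← baseChange_subtype_injective σ hyx]
  · refine Submodule.span_le.2 ?_
    rintro _ ⟨t, ht, rfl⟩
    change (spanLattice σ).subtype.baseChange ℝ (latticeVec t) ∈ σ
    rw [baseChange_subtype_latticeVec]
    exact hTmem _ ht

theorem IsToricCone.spanCone (hσ : IsToricCone σ) : IsToricCone (spanCone σ) := by
  classical
  obtain ⟨T, hT⟩ := hσ.rational_polyhedral
  refine ⟨⟨T.preimage (spanLattice σ).subtype (Submodule.subtype_injective _).injOn, ?_⟩, ?_⟩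
  · rw [Finset.coe_preimage]
    exact spanCone_eq_hull hT
  · intro x hx hx'
    apply baseChange_subtype_injective σ
    rw [map_zero]
    exact hσ.strongly_convex _ hx (by rw [← map_neg]; exact hx')

theorem IsToricCone.isFullDimensional_spanCone (hσ : IsToricCone σ) :
    IsFullDimensional (_root_.spanCone σ) := by
  obtain ⟨T, hT⟩ := hσ.rational_polyhedral
  rw [IsFullDimensional, eq_top_iff, ← span_range_latticeVec, Submodule.span_le]
  rintro _ ⟨v, rfl⟩
  have hv := mem_spanLattice.1 v.2
  have : Submodule.span ℝ (σ : Set (LatticeReal N)) ≤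
      (Submodule.span ℝ (_root_.spanCone σ : Set (LatticeReal (spanLattice σ)))).map
        ((spanLattice σ).subtype.baseChange ℝ) := by
    rw [Submodule.span_le]
    intro x hx
    rw [hT] at hx
    refine Submodule.span_le.2 ?_ (PointedCone.hull_le_span ℝ _ hx)
    rintro _ ⟨t, ht, rfl⟩
    have htσ : latticeVec t ∈ σ := by rw [hT]; exact Submodule.subset_span ⟨t, ht, rfl⟩
    have htm : t ∈ spanLattice σ := mem_spanLattice.2 (Submodule.subset_span htσ)
    refine ⟨latticeVec ⟨t, htm⟩, Submodule.subset_span ?_, baseChange_subtype_latticeVec _⟩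
    change (spanLattice σ).subtype.baseChange ℝ (latticeVec ⟨t, htm⟩) ∈ σ
    rw [baseChange_subtype_latticeVec]
    exact htσ
  obtain ⟨y, hy, hyv⟩ := this hv
  rw [← baseChange_subtype_latticeVec] at hyv
  rwa [← baseChange_subtype_injective σ hyv]

theorem IsToricCone.mem_toricMonoid_iff_spanCone (hσ : IsToricCone σ) {m : Module.Dual ℤ N} :
    m ∈ toricMonoid σ ↔ m ∘ₗ (spanLattice σ).subtype ∈ toricMonoid (_root_.spanCone σ) := by
  obtain ⟨T, hT⟩ := hσ.rational_polyhedral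
  rw [spanCone_eq_hull hT, mem_toricMonoid_hull]
  conv_lhs => rw [hT, mem_toricMonoid_hull]
  refine ⟨fun h t ht => h _ ht, fun h t ht => ?_⟩
  have htσ : latticeVec t ∈ σ := by rw [hT]; exact Submodule.subset_span ⟨t, ht, rfl⟩
  exact h ⟨t, mem_spanLattice.2 (Submodule.subset_span htσ)⟩ ht

/-- The preimage of a submonoid under a split surjection is a product. -/
def addEquivOfSplit {M M' : Type*} [AddCommGroup M] [AddCommGroup M'] {S : AddSubmonoid M}
    {S' : AddSubmonoid M'} (f : M →ₗ[ℤ] M') (s : M' →ₗ[ℤ] M) (hfs : ∀ m, f (s m) = m)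
    (hS : ∀ m, m ∈ S ↔ f m ∈ S') : S' × LinearMap.ker f ≃+ S where
  toFun x := ⟨s x.1 + x.2, (hS _).2 (by
    rw [map_add, hfs, LinearMap.mem_ker.1 x.2.2, add_zero]; exact x.1.2)⟩
  invFun y := (⟨f y, (hS _).1 y.2⟩, ⟨y - s (f y), by simp [hfs]⟩)
  left_inv x := by
    have : f x.2 = 0 := x.2.2
    ext <;> simp [hfs, this]
  right_inv y := by ext; simp
  map_add' x y := by
    apply Subtype.ext
    simp only [Prod.fst_add, Prod.snd_add, AddSubmonoid.coe_add, Submodule.coe_add, map_add]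
    abel

/-- The semigroup of a cone is the product of the semigroup of the cone in its span and a
lattice. -/
theorem IsToricCone.exists_toricMonoid_addEquiv (hσ : IsToricCone σ) :
    ∃ r : ℕ, Nonempty (toricMonoid (_root_.spanCone σ) × (Fin r → ℤ) ≃+ toricMonoid σ) := by
  obtain ⟨ρ, hρ⟩ := exists_retraction_spanLattice σ
  let res : Module.Dual ℤ N →ₗ[ℤ] Module.Dual ℤ (spanLattice σ) :=
    LinearMap.lcomp ℤ ℤ (spanLattice σ).subtype
  have hres (m) : res (m ∘ₗ ρ) = m := by
    change (m ∘ₗ ρ) ∘ₗ (spanLattice σ).subtype = m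
    rw [LinearMap.comp_assoc, hρ, LinearMap.comp_id]
  -- The torus characters are the forms that vanish on `N'`, a free group of finite rank.
  let B := (Module.finBasis ℤ (LinearMap.ker res)).equivFun.symm.toAddEquiv
  exact ⟨_, ⟨((AddEquiv.refl _).prodCongr B).trans (addEquivOfSplit res
    (LinearMap.lcomp ℤ ℤ ρ) hres fun m => hσ.mem_toricMonoid_iff_spanCone)⟩⟩

end SpanCone

/-! ### Products of varieties as tensor products of semigroup rings. -/

section Tensor

open AddMonoidAlgebra

/-- The semigroup ring of a product is the tensor product of the semigroup rings. -/
def tensorAddMonoidAlgebraEquiv (k A B : Type*) [Field k] [AddCommMonoid A] [AddCommMonoid B] :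
    AddMonoidAlgebra k A ⊗[k] AddMonoidAlgebra k B ≃ₐ[k] AddMonoidAlgebra k (A × B) :=
  AlgEquiv.ofAlgHom
    (Algebra.TensorProduct.productMap (mapDomainAlgHom k k (AddMonoidHom.inl A B))
      (mapDomainAlgHom k k (AddMonoidHom.inr A B)))
    (AddMonoidAlgebra.lift k _ (A × B)
      { toFun := fun x => single x.toAdd.1 1 ⊗ₜ single x.toAdd.2 1
        map_one' := rfl
        map_mul' := fun x y => by
          simp [Algebra.TensorProduct.tmul_mul_tmul, single_mul_single] })
    (by ext; simp [single_mul_single])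
    (by
      apply Algebra.TensorProduct.ext
      · ext a; simp [one_def]
      · ext b; simp [one_def])

end Tensor

/-- The F-signature of an affine toric variety is the volume of the polytope of the cone in its
span. -/
theorem IsToricCone.hasFSignature_spanCone {N : Type*} [AddCommGroup N] [Module.Free ℤ N]
    [Module.Finite ℤ N] {σ : PointedCone ℝ (LatticeReal N)} {p : ℕ} {k : Type*} [Field k]
    [ExpChar k p] [PerfectRing k p] (hp : 1 < p) (hσ : IsToricCone σ) :
    HasFSignature p (ToricRing k σ) (latticeVolume (toricPolytope (_root_.spanCone σ))).toReal := by
  obtain ⟨r, ⟨φ⟩⟩ := hσ.exists_toricMonoid_addEquiv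
  exact ((hσ.spanCone.hasFSignature hp hσ.isFullDimensional_spanCone).prod_torus
    hσ.spanCone.isFullSaturated r).congr (AddMonoidAlgebra.domCongr k k φ).toRingEquiv

end

theorem theorem3p2 (p : ℕ) [Fact p.Prime] (k : Type*) [Field k] [CharP k p]
    [PerfectField k]
    (N : Type*) [AddCommGroup N] [Module.Free ℤ N] [Module.Finite ℤ N]
    (σ : PointedCone ℝ (LatticeReal N)) (hσ : IsToricCone σ) :
    -- the toric variety of `σ` has no torus factors
    (IsFullDimensional σ →
      latticeVolume (toricPolytope σ) ≠ ⊤ ∧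
      HasFSignature p (ToricRing k σ) (latticeVolume (toricPolytope σ)).toReal) ∧
    -- the general case, with the toric variety of `σ'` as `X'`
    (latticeVolume (toricPolytope (spanCone σ)) ≠ ⊤ ∧
      HasFSignature p (ToricRing k σ) (latticeVolume (toricPolytope (spanCone σ))).toReal ∧
      HasFSignature p (ToricRing k (spanCone σ))
        (latticeVolume (toricPolytope (spanCone σ))).toReal) ∧
    -- the general case, for every `X'` without torus factors and every torus `T = Spec k[ℤ^r]`
    -- such that `X` is isomorphic to `X' × T`
    (∀ (N₁ : Type*) [AddCommGroup N₁] [Module.Free ℤ N₁] [Module.Finite ℤ N₁]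
      (τ : PointedCone ℝ (LatticeReal N₁)) (r : ℕ), IsToricCone τ → IsFullDimensional τ →
      Nonempty (ToricRing k σ ≃ₐ[k] ToricRing k τ ⊗[k] AddMonoidAlgebra k (Fin r → ℤ)) →
      HasFSignature p (ToricRing k τ)
        (latticeVolume (toricPolytope (spanCone σ))).toReal) := by
  have hp : 1 < p := (Fact.out : p.Prime).one_lt
  have : ExpChar k p := ExpChar.prime Fact.out
  refine ⟨fun hfull => ⟨hσ.latticeVolume_ne_top hfull, hσ.hasFSignature hp hfull⟩,
    ⟨hσ.spanCone.latticeVolume_ne_top hσ.isFullDimensional_spanCone,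
      hσ.hasFSignature_spanCone hp, hσ.spanCone.hasFSignature hp hσ.isFullDimensional_spanCone⟩, ?_⟩
  rintro N₁ _ _ _ τ r hτ hfull ⟨φ⟩
  have h := hτ.hasFSignature (k := k) hp hfull
  have h' : HasFSignature p (ToricRing k σ) _ := (h.prod_torus hτ.isFullSaturated r).congr
    (φ.trans (tensorAddMonoidAlgebraEquiv k _ _)).symm.toRingEquiv
  -- No relation between `τ` and the cone `σ'` is needed: both compute the signature of `k[X]`,
  -- which is unique.
  rwa [h'.unique (hσ.hasFSignature_spanCone hp)] at h
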